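/- Let $d\ge 1$ and $\mathbb N=\{1,2,\dots\}$. For $\mathbf x\in((0,1)\setminus\mathbb Q)^d$ let $\mathbf a_n(\mathbf x)=(a_n(x_1),\dots,a_n(x_d))\in\mathbb N^d$, where $a_n(x_j)$ is the $n$-th partial quotient of the regular continued fraction of $x_j$. Let $$E^{\mathrm{vec}}=\{\mathbf x\in((0,1)\setminus\mathbb Q)^d:\ \mathbf a_m(\mathbf x)\ne\mathbf a_n(\mathbf x)\text{ for all }m\ne n\},$$ $$\mathcal E=\{\mathbf x\in((0,1)\setminus\mathbb Q)^d:\ a_n(x_j)\to\infty\ (n\to\infty)\text{ for each }j\}.$$ For $X\in\{E^{\mathrm{vec}},\mathcal E\}$, $t>L>1$ and $K\subset\mathbb N^d$ put $$R^X_{t,L}(K)=\{\mathbf x\in X:\ \mathbf a_n(\mathbf x)\in K\text{ and }t^n\le\|\mathbf a_n(\mathbf x)\|_\infty<Lt^n\text{ for all }n\ge1\}.$$ With $Q_N=\{1,\dots,N\}^d$, a set $S\subset\mathbb N^d$ has polynomial density of exponent $\alpha\ge1$ if there are $\beta\in\mathbb R$ and $c,C>0$ with $c\,N^{d/\alpha}(\log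 N)^{-\beta}\le|S\cap Q_N|\le C\,N^{d/\alpha}(\log N)^{-\beta}$ for all large $N$. For $A\subset S$ let $\overline d(A\mid S)=\limsup_{N\to\infty}|A\cap Q_N|/|S\cap Q_N|$. We call $R^X_{t,L}(K)$ an extreme seed set associated with $S$ if $S$ is infinite and has polynomial density of exponent $\alpha\ge1$, $K\subset S$ is infinite, $t>L>1$, $R^X_{t,L}(K)\neq\varnothing$, any two distinct elements of $K$ are at $\ell^\infty$-distance at least $2$, $\overline d(K\mid S)=0$, and $\dim_H R^X_{t,L}(K)\ge d/(2\alpha)$. **Proposition.** Let $S\subset\mathbb N^d$ have polynomial density of exponent $\alpha\ge1$. Then there exist $S^\ast\subset S$ with $\overline d(S^\ast\mid S)=0$ and numbers $t_0>L>1$ such that, for every $t\ge t_0$, $R^{E^{\mathrm{vec}}}_{t,L}(S^\ast)$ is an extreme seed set associated with $S$; in particular $S^\ast$ is $2$-separated and $\dim_H R^{E^{\mathrm{vec}}}_{t,L}(S^\ast)\ge d/(2\alpha)$. If in addition there is $K\ge1$ such that $\max_j a_j\le K\min_j a_j$ for all $\mathbf a\in S$, then for these $S^\ast$, $L$ and every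 $t\ge t_0$ $$\dim_H R^{E^{\mathrm{vec}}}_{t,L}(S^\ast)=\frac{d}{2\alpha},$$ and all of this remains true with $\mathcal E$ in place of $E^{\mathrm{vec}}$: $R^{\mathcal E}_{t,L}(S^\ast)$ is an extreme seed set associated with $S$ and $\dim_H R^{\mathcal E}_{t,L}(S^\ast)=d/(2\alpha)$. -/

import Mathlib

open Filter Topology

noncomputable section

namespace CFSeed

/-! ### Coordinatewise continued fraction digits -/

/-- The Gauss map `x ↦ {1 / x}`. -/
def gaussMap (x : ℝ) : ℝ := Int.fract x⁻¹

/-- The partial quotients of `x ∈ (0,1) \ ℚ`, indexed from `0`: `digit x n` is the `(n+1)`-st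
partial quotient `a_{n+1}(x)` of `x = [0; a_1(x), a_2(x), …]`. -/
def digit (x : ℝ) (n : ℕ) : ℕ := ⌊(gaussMap^[n] x)⁻¹⌋₊

/-- `digit` agrees with Mathlib's regular continued fraction expansion. -/
theorem get?_of_eq_digit (x : ℝ) (hx : Irrational x) (hx0 : 0 < x) (hx1 : x < 1) (n : ℕ) :
    (GenContFract.of x).s.get? n = some ⟨1, (digit x n : ℝ)⟩ := by
  have key : ∀ (n : ℕ) (v : ℝ), Irrational v →
      (GenContFract.of v).s.get? n = some ⟨1, (digit (Int.fract v) n : ℝ)⟩ := by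
    intro n
    induction n with
    | zero =>
      intro v hv
      have hne : Int.fract v ≠ 0 := by
        intro h
        rw [Int.fract, sub_eq_zero] at h
        exact hv ⟨(⌊v⌋ : ℚ), by rw [Rat.cast_intCast]; exact h.symm⟩
      have h0 : 0 ≤ (Int.fract v)⁻¹ := inv_nonneg.mpr (Int.fract_nonneg v)
      have h1 := GenContFract.of_s_head hne
      rw [show (GenContFract.of v).s.get? 0 = (GenContFract.of v).s.head from rfl, h1]
      simp only [digit, Function.iterate_zero, id_eq]
      rw [natCast_floor_eq_intCast_floor h0]
    | succ n ih =>
      intro v hv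
      have hf : Irrational (Int.fract v) := by
        rw [Int.fract]; exact hv.sub_intCast _
      rw [GenContFract.of_s_succ, ih _ hf.inv]
      rfl
  have h := key n x hx
  rwa [Int.fract_eq_self.mpr ⟨hx0.le, hx1⟩] at h

variable {d : ℕ}

/-- The digit vector `𝐚_{n+1}(𝐱) = (a_{n+1}(x_1), …, a_{n+1}(x_d))`. -/
def digitVec (x : Fin d → ℝ) (n : ℕ) : Fin d → ℕ := fun j => digit (x j) n

/-! ### Subsets of the lattice of positive integer vectors -/

/-- The vectors all of whose coordinates are positive integers. -/
def posVec (d : ℕ) : Set (Fin d → ℕ) := {v | ∀ j, 1 ≤ v j}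

/-- The box `Q_N = [1, N]^d`. -/
def box (d N : ℕ) : Set (Fin d → ℕ) := {v | ∀ j, 1 ≤ v j ∧ v j ≤ N}

/-- The sup norm `‖v‖_∞` of a vector of natural numbers. -/
def supNorm (v : Fin d → ℕ) : ℕ := Finset.univ.sup v

/-- The vectors with `max_j v_j ≤ K * min_j v_j`. -/
def balanced (d : ℕ) (K : ℝ) : Set (Fin d → ℕ) :=
  {v | v ∈ posVec d ∧ ∀ i j, (v i : ℝ) ≤ K * v j}

/-- Polynomial density of exponent `α`: `|S ∩ Q_N| ≍ N^{d/α} / (log N)^β` for some `β`. -/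
def HasPolyDensity (S : Set (Fin d → ℕ)) (α : ℝ) : Prop :=
  ∃ β c C : ℝ, 0 < c ∧ 0 < C ∧ ∀ᶠ N : ℕ in atTop,
    c * ((N : ℝ) ^ ((d : ℝ) / α) / Real.log N ^ β) ≤ ((S ∩ box d N).ncard : ℝ) ∧
    ((S ∩ box d N).ncard : ℝ) ≤ C * ((N : ℝ) ^ ((d : ℝ) / α) / Real.log N ^ β)

/-- The relative upper density of `A` in `S`, for `A ⊆ S`
(the quotients then lie in `[0, 1]`). -/
def relUpperDensity (A S : Set (Fin d → ℕ)) : ℝ :=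
  limsup (fun N : ℕ => ((A ∩ box d N).ncard : ℝ) / ((S ∩ box d N).ncard : ℝ)) atTop

/-- Distinct elements are at sup-distance at least `2` (`dist` on `Fin d → ℕ` is the
sup-distance): the set contains no nearest neighbour pairs. -/
def TwoSeparated (A : Set (Fin d → ℕ)) : Prop :=
  A.Pairwise fun v w => 2 ≤ dist v w

/-! ### Seed sets

Points live in `Fin d → ℝ` with its sup metric, which is bi-Lipschitz equivalent to the Euclidean
metric and hence gives the same Hausdorff dimension `dimH`. -/

/-- The points of `(0,1)^d` all of whose coordinates are irrational. -/
def irrCube (d : ℕ) : Set (Fin d → ℝ) := {x | ∀ j, Irrational (x j) ∧ 0 < x j ∧ x j < 1}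

/-- The points of `((0,1) \ ℚ)^d` whose digit vectors are pairwise distinct. -/
def injSpace (d : ℕ) : Set (Fin d → ℝ) :=
  {x | x ∈ irrCube d ∧ ∀ m n, m ≠ n → digitVec x m ≠ digitVec x n}

/-- The points of `((0,1) \ ℚ)^d` for which the digits of every coordinate tend to infinity. -/
def divSpace (d : ℕ) : Set (Fin d → ℝ) :=
  {x | x ∈ irrCube d ∧ ∀ j, Tendsto (fun n => digit (x j) n) atTop atTop}

/-- The set of points `𝐱` of the ambient space `X` with
`𝐚_n(𝐱) ∈ K` and `t^n ≤ ‖𝐚_n(𝐱)‖_∞ < L t^n` for all `n ≥ 1`. -/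
def seedSet (X : Set (Fin d → ℝ)) (t L : ℝ) (K : Set (Fin d → ℕ)) : Set (Fin d → ℝ) :=
  {x | x ∈ X ∧ ∀ n : ℕ, digitVec x n ∈ K ∧
    t ^ (n + 1) ≤ (supNorm (digitVec x n) : ℝ) ∧
    (supNorm (digitVec x n) : ℝ) < L * t ^ (n + 1)}

/-- The set `seedSet X t L K` is an extreme seed set associated with `S`, where `S` has polynomial
density of exponent `α`. -/
structure IsExtremeSeedSet (X : Set (Fin d → ℝ)) (S : Set (Fin d → ℕ)) (α t L : ℝ)
    (K : Set (Fin d → ℕ)) : Prop where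
  infinite_ambient : S.Infinite
  subset : K ⊆ S
  infinite : K.Infinite
  one_lt : 1 < L
  lt : L < t
  nonempty : (seedSet X t L K).Nonempty
  one_le : 1 ≤ α
  polyDensity : HasPolyDensity S α
  twoSeparated : TwoSeparated K
  relUpperDensity_eq_zero : relUpperDensity K S = 0
  le_dimH : ENNReal.ofReal ((d : ℝ) / (2 * α)) ≤ dimH (seedSet X t L K)

end CFSeed

end

noncomputable section

namespace CFSeed

/-! A point of the seed set is a sequence of independent choices of digit vectors, the n-th one from
the shell t^n ≤ ‖v‖ < L t^n of the thinned set. As L < t, the shells are disjoint, so the digit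
vectors are automatically distinct; if S is balanced, every coordinate is at least t^n / K and
diverges. Hence both seed sets equal `shellSet`.

Fixing n digit vectors of size t^i pins the point down to a scale of about ∏ t^(-2i), while the
number of choices is about ∏ t^(i d/α), up to factors absorbed by an ε in the exponent. The quotient
of the exponents is d/(2α).

Lower bound (`le_dimH_of_branching`): mixed radix expansions map [0,1) into the set, and the inverse
is Hölder because 2-separated digits force gaps between cylinders. Upper bound
(`dimH_le_of_digit_cover`): cover by cylinders; balance is needed so that these are small in every
coordinate.

The thin set (`exists_thin_subset`) keeps, in every second b-adic annulus of S, a proportion of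
order 1/(k+1) of the vectors within one parity class. The proportion tends to 0, giving density
zero, but only like the inverse of the logarithm of the norm, so no exponent is lost. -/

/-! ### Continued fractions with prescribed digits -/

/-- The irrational numbers of the unit interval. -/
def unitIrr : Set ℝ := {x | Irrational x ∧ 0 < x ∧ x < 1}

theorem digit_succ (x : ℝ) (n : ℕ) : digit x (n + 1) = digit (gaussMap x) n := rfl

theorem inv_eq_digit_add {x : ℝ} (hx : 0 ≤ x) : x⁻¹ = digit x 0 + gaussMap x := by
  have h0 : 0 ≤ x⁻¹ := inv_nonneg.mpr hx
  simp only [digit, Function.iterate_zero, id_eq, gaussMap]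
  rw [natCast_floor_eq_intCast_floor h0, Int.floor_add_fract]

theorem gaussMap_mem {x : ℝ} (hx : x ∈ unitIrr) : gaussMap x ∈ unitIrr := by
  have hf : Irrational (gaussMap x) := by
    rw [gaussMap, Int.fract]; exact hx.1.inv.sub_intCast _
  exact ⟨hf, lt_of_le_of_ne (Int.fract_nonneg _) hf.ne_zero.symm, Int.fract_lt_one _⟩

theorem one_le_digit_zero {x : ℝ} (hx : x ∈ unitIrr) : 1 ≤ digit x 0 := by
  simp only [digit, Function.iterate_zero, id_eq]
  exact Nat.le_floor (by simpa using (one_lt_inv₀ hx.2.1 |>.mpr hx.2.2).le)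

theorem one_le_digit {x : ℝ} (hx : x ∈ unitIrr) (n : ℕ) : 1 ≤ digit x n := by
  induction n generalizing x with
  | zero => exact one_le_digit_zero hx
  | succ n ih => exact ih (gaussMap_mem hx)

theorem abs_inv_sub_inv {u v : ℝ} (hu : 0 < u) (hv : 0 < v) :
    |u⁻¹ - v⁻¹| = |u - v| / (u * v) := by
  rw [inv_sub_inv hu.ne' hv.ne', abs_div, abs_of_pos (mul_pos hu hv), abs_sub_comm]

theorem abs_sub_eq {x y : ℝ} (hx : x ∈ unitIrr) (hy : y ∈ unitIrr) :
    |x - y| = |(digit x 0 + gaussMap x) - (digit y 0 + gaussMap y)| /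
      ((digit x 0 + gaussMap x) * (digit y 0 + gaussMap y)) := by
  rw [← inv_eq_digit_add hx.2.1.le, ← inv_eq_digit_add hy.2.1.le,
    ← abs_inv_sub_inv (inv_pos.mpr hx.2.1) (inv_pos.mpr hy.2.1), inv_inv, inv_inv]

/-- Iterate `abs_sub_eq`: a common first digit cancels in the numerator, and both factors of the
denominator are at least `b 0`. -/
theorem abs_sub_le_prod_of_digit_eq (b : ℕ → ℝ) (n : ℕ) {x y : ℝ} (hx : x ∈ unitIrr)
    (hy : y ∈ unitIrr) (hb : ∀ i < n, 0 < b i ∧ b i ≤ digit x i)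
    (h : ∀ i < n, digit x i = digit y i) :
    |x - y| ≤ ∏ i ∈ Finset.range n, 1 / b i ^ 2 := by
  induction n generalizing x y b with
  | zero =>
    simp only [Finset.range_zero, Finset.prod_empty]
    have := hx.2; have := hy.2
    rw [abs_le]; constructor <;> linarith
  | succ n ih =>
    rw [Finset.prod_range_succ', abs_sub_eq hx hy, ← h 0 (Nat.succ_pos n)]
    have hgx := gaussMap_mem hx
    have hgy := gaussMap_mem hy
    obtain ⟨hb0, hb1⟩ := hb 0 (Nat.succ_pos n)
    have ih' := ih (fun i => b (i + 1)) hgx hgy (fun i hi => hb (i + 1) (by omega))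
      (fun i hi => h (i + 1) (by omega))
    rw [add_sub_add_left_eq_sub, div_eq_mul_one_div]
    have h1 : b 0 ≤ digit x 0 + gaussMap x := by linarith [hgx.2.1]
    have h2 : b 0 ≤ digit x 0 + gaussMap y := by linarith [hgy.2.1]
    have h0 := hb0.le.trans h1
    have h3 := mul_pos (hb0.trans_le h1) (hb0.trans_le h2)
    gcongr
    rw [sq]; gcongr

/-- At the first differing digit the integer parts are 2 apart and the fractional parts less than 1
apart, so the inverses differ by at least 1. Adjacent digits would give no gap, which is why
2-separation is required. -/
theorem prod_le_abs_sub_of_digit_separated (B : ℕ → ℝ) (n : ℕ) {x y : ℝ} (hx : x ∈ unitIrr)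
    (hy : y ∈ unitIrr) (hBx : ∀ i ≤ n, digit x i + 1 ≤ B i) (hBy : ∀ i ≤ n, digit y i + 1 ≤ B i)
    (h : ∀ i < n, digit x i = digit y i) (hn : (2 : ℝ) ≤ |(digit x n : ℝ) - digit y n|) :
    ∏ i ∈ Finset.range (n + 1), 1 / B i ^ 2 ≤ |x - y| := by
  induction n generalizing x y B with
  | zero =>
    have hgx := gaussMap_mem hx
    have hgy := gaussMap_mem hy
    have hx0 := hBx 0 le_rfl
    have hy0 := hBy 0 le_rfl
    have hdx : (1 : ℝ) ≤ digit x 0 := by exact_mod_cast one_le_digit hx 0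
    have hdy : (1 : ℝ) ≤ digit y 0 := by exact_mod_cast one_le_digit hy 0
    rw [abs_sub_eq hx hy]
    simp only [zero_add, Finset.range_one, Finset.prod_singleton]
    have := hgx.2; have := hgy.2
    have h1 : 1 ≤ |(digit x 0 + gaussMap x) - (digit y 0 + gaussMap y)| := by
      rcases le_abs.mp hn with h | h
      · exact le_abs.mpr (Or.inl (by linarith))
      · exact le_abs.mpr (Or.inr (by linarith))
    have h2 : digit x 0 + gaussMap x ≤ B 0 := by linarith
    have h3 : digit y 0 + gaussMap y ≤ B 0 := by linarith
    have h4 : 0 < digit x 0 + gaussMap x := by linarith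
    have h5 : 0 < digit y 0 + gaussMap y := by linarith
    have h6 := h4.le.trans h2
    rw [sq]
    gcongr
  | succ n ih =>
    have hgx := gaussMap_mem hx
    have hgy := gaussMap_mem hy
    have ih' := ih (fun i => B (i + 1)) hgx hgy (fun i hi => hBx (i + 1) (by omega))
      (fun i hi => hBy (i + 1) (by omega)) (fun i hi => h (i + 1) (by omega)) hn
    have hx0 := hBx 0 (Nat.zero_le _)
    have hdx : (1 : ℝ) ≤ digit x 0 := by exact_mod_cast one_le_digit hx 0
    rw [Finset.prod_range_succ', abs_sub_eq hx hy, ← h 0 (Nat.succ_pos n),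
      add_sub_add_left_eq_sub, div_eq_mul_one_div |gaussMap x - gaussMap y|]
    have := hgx.2; have := hgy.2
    have h2 : digit x 0 + gaussMap x ≤ B 0 := by linarith
    have h3 : digit x 0 + gaussMap y ≤ B 0 := by linarith
    have h4 : 0 < digit x 0 + gaussMap x := by linarith
    have h5 : 0 < digit x 0 + gaussMap y := by linarith
    have h6 := h4.le.trans h2
    gcongr
    rw [sq]; gcongr

/-! ### Existence of an irrational number with prescribed digits, by nested cylinders -/

/-- The closed set of numbers `1 / (a 0 + 1 / (a 1 + ⋯ + 1 / (a (n - 1) + y)))`, `y ∈ [0, 1]`. -/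
def cylinder : ℕ → (ℕ → ℕ) → Set ℝ
  | 0, _ => Set.Icc 0 1
  | n + 1, a => (fun y : ℝ => (a 0 + y)⁻¹) '' cylinder n (fun i => a (i + 1))

theorem cylinder_succ_subset_aux {a : ℕ} (ha : 1 ≤ a) {y : ℝ} (hy : 0 ≤ y) :
    ((a : ℝ) + y)⁻¹ ∈ Set.Icc (0 : ℝ) 1 := by
  have : (1 : ℝ) ≤ a := by exact_mod_cast ha
  exact ⟨by positivity, inv_le_one_of_one_le₀ (by linarith)⟩

theorem cylinder_subset_Icc (n : ℕ) {a : ℕ → ℕ} (ha : ∀ i, 1 ≤ a i) :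
    cylinder n a ⊆ Set.Icc 0 1 := by
  induction n generalizing a with
  | zero => exact subset_rfl
  | succ n ih =>
    rintro _ ⟨y, hy, rfl⟩
    exact cylinder_succ_subset_aux (ha 0) (ih (fun i => ha (i + 1)) hy).1

theorem cylinder_succ_subset (n : ℕ) {a : ℕ → ℕ} (ha : ∀ i, 1 ≤ a i) :
    cylinder (n + 1) a ⊆ cylinder n a := by
  induction n generalizing a with
  | zero => exact cylinder_subset_Icc 1 ha
  | succ n ih => exact Set.image_mono (ih (fun i => ha (i + 1)))

theorem isCompact_cylinder (n : ℕ) {a : ℕ → ℕ} (ha : ∀ i, 1 ≤ a i) :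
    IsCompact (cylinder n a) := by
  induction n generalizing a with
  | zero => exact isCompact_Icc
  | succ n ih =>
    refine (ih (fun i => ha (i + 1))).image_of_continuousOn ?_
    refine ContinuousOn.inv₀ (by fun_prop) fun y hy => ?_
    have h0 := (cylinder_subset_Icc n (fun i => ha (i + 1)) hy).1
    have : (1 : ℝ) ≤ a 0 := by exact_mod_cast ha 0
    positivity

theorem cylinder_nonempty (n : ℕ) (a : ℕ → ℕ) : (cylinder n a).Nonempty := by
  induction n generalizing a with
  | zero => exact ⟨0, by simp [cylinder]⟩
  | succ n ih => exact (ih _).image _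

theorem iInter_cylinder_nonempty {a : ℕ → ℕ} (ha : ∀ i, 1 ≤ a i) :
    (⋂ n, cylinder n a).Nonempty :=
  IsCompact.nonempty_iInter_of_sequence_nonempty_isCompact_isClosed _
    (fun n => cylinder_succ_subset n ha) (fun n => cylinder_nonempty n a)
    (isCompact_cylinder 0 ha) (fun n => (isCompact_cylinder n ha).isClosed)

/-- The tail is determined by x as x⁻¹ - a 0, so one y serves all n at once. -/
theorem exists_mem_iInter_cylinder_shift {a : ℕ → ℕ} {x : ℝ}
    (hx : x ∈ ⋂ n, cylinder n a) :
    ∃ y ∈ ⋂ n, cylinder n (fun i => a (i + 1)), x = (a 0 + y)⁻¹ := by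
  rw [Set.mem_iInter] at hx
  refine ⟨x⁻¹ - a 0, Set.mem_iInter.mpr fun n => ?_, by simp⟩
  obtain ⟨y, hy, rfl⟩ := hx (n + 1)
  simpa using hy

/-- Closed cylinders contain rational endpoints. Peeling off one digit gives the strict lower bound,
and a second peeling the strict upper bound; both are needed to read off digits by floors. -/
theorem pos_of_mem_iInter_cylinder {a : ℕ → ℕ} (ha : ∀ i, 1 ≤ a i) {x : ℝ}
    (hx : x ∈ ⋂ n, cylinder n a) : 0 < x := by
  obtain ⟨y, hy, rfl⟩ := exists_mem_iInter_cylinder_shift hx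
  have h0 := (cylinder_subset_Icc 0 (fun i => ha (i + 1)) (Set.mem_iInter.mp hy 0)).1
  have : (1 : ℝ) ≤ a 0 := by exact_mod_cast ha 0
  positivity

theorem lt_one_of_mem_iInter_cylinder {a : ℕ → ℕ} (ha : ∀ i, 1 ≤ a i) {x : ℝ}
    (hx : x ∈ ⋂ n, cylinder n a) : x < 1 := by
  obtain ⟨y, hy, rfl⟩ := exists_mem_iInter_cylinder_shift hx
  have h0 := pos_of_mem_iInter_cylinder (fun i => ha (i + 1)) hy
  have : (1 : ℝ) ≤ a 0 := by exact_mod_cast ha 0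
  exact inv_lt_one_of_one_lt₀ (by linarith)

theorem digit_of_mem_iInter_cylinder (n : ℕ) {a : ℕ → ℕ} (ha : ∀ i, 1 ≤ a i) {x : ℝ}
    (hx : x ∈ ⋂ n, cylinder n a) : digit x n = a n := by
  induction n generalizing a x with
  | zero =>
    obtain ⟨y, hy, rfl⟩ := exists_mem_iInter_cylinder_shift hx
    have h0 := pos_of_mem_iInter_cylinder (fun i => ha (i + 1)) hy
    have h1 := lt_one_of_mem_iInter_cylinder (fun i => ha (i + 1)) hy
    simp only [digit, Function.iterate_zero, id_eq, inv_inv]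
    rw [Nat.floor_eq_iff (by positivity)]
    constructor <;> linarith
  | succ n ih =>
    obtain ⟨y, hy, rfl⟩ := exists_mem_iInter_cylinder_shift hx
    have h0 := pos_of_mem_iInter_cylinder (fun i => ha (i + 1)) hy
    have h1 := lt_one_of_mem_iInter_cylinder (fun i => ha (i + 1)) hy
    have hg : gaussMap ((a 0 + y)⁻¹) = y := by
      rw [gaussMap, inv_inv, Int.fract_natCast_add, Int.fract_eq_self]
      exact ⟨h0.le, h1⟩
    rw [digit_succ, hg, ih (fun i => ha (i + 1)) hy]

/-- Infinite descent on the denominator: if x = p/q, then the tail is (q - a 0 * p)/p, with p < q.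
-/
theorem irrational_of_mem_iInter_cylinder {a : ℕ → ℕ} (ha : ∀ i, 1 ≤ a i) {x : ℝ}
    (hx : x ∈ ⋂ n, cylinder n a) : Irrational x := by
  have key : ∀ (q : ℕ) (a : ℕ → ℕ), (∀ i, 1 ≤ a i) → ∀ x ∈ ⋂ n, cylinder n a, ∀ p : ℤ,
      0 < q → x * q = p → False := by
    intro q
    induction q using Nat.strong_induction_on with
    | _ q ih =>
      intro a ha x hx p hq hp
      have hx0 := pos_of_mem_iInter_cylinder ha hx
      have hx1 := lt_one_of_mem_iInter_cylinder ha hx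
      obtain ⟨y, hy, rfl⟩ := exists_mem_iInter_cylinder_shift hx
      have hy0 := pos_of_mem_iInter_cylinder (fun i => ha (i + 1)) hy
      have hq' : (0 : ℝ) < q := by exact_mod_cast hq
      have hp0 : 0 < p := by
        have : (0 : ℝ) < p := by rw [← hp]; positivity
        exact_mod_cast this
      have hpq : p < q := by
        have : (p : ℝ) < q := by rw [← hp]; nlinarith
        exact_mod_cast this
      lift p to ℕ using hp0.le
      refine ih p (by exact_mod_cast hpq) _ (fun i => ha (i + 1)) y hy (q - a 0 * p)
        (by exact_mod_cast hp0) ?_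
      have hne : (a 0 + y : ℝ) ≠ 0 := by positivity
      push_cast at hp ⊢
      field_simp at hp
      linarith
  rintro ⟨q, rfl⟩
  refine key q.den a ha _ hx q.num q.den_pos ?_
  exact_mod_cast Rat.mul_den_eq_num q

theorem exists_digit_eq {a : ℕ → ℕ} (ha : ∀ i, 1 ≤ a i) :
    ∃ x ∈ unitIrr, ∀ n, digit x n = a n := by
  obtain ⟨x, hx⟩ := iInter_cylinder_nonempty ha
  exact ⟨x, ⟨irrational_of_mem_iInter_cylinder ha hx, pos_of_mem_iInter_cylinder ha hx,
    lt_one_of_mem_iInter_cylinder ha hx⟩, fun n => digit_of_mem_iInter_cylinder n ha hx⟩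

theorem exists_digitVec_eq {d : ℕ} {a : ℕ → Fin d → ℕ} (ha : ∀ n, a n ∈ posVec d) :
    ∃ x ∈ irrCube d, ∀ n, digitVec x n = a n := by
  choose x hx hxa using fun j : Fin d => exists_digit_eq (a := fun n => a n j) (fun n => ha n j)
  exact ⟨x, hx, fun n => funext fun j => hxa j n⟩

/-! ### Lattice point counts -/

section Counting

variable {d : ℕ}

/-- The elements of `S` with sup norm in `[a, b)`. -/
def shell (S : Set (Fin d → ℕ)) (a b : ℝ) : Set (Fin d → ℕ) :=
  {v ∈ S | a ≤ (supNorm v : ℝ) ∧ (supNorm v : ℝ) < b}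

theorem le_supNorm (v : Fin d → ℕ) (j : Fin d) : v j ≤ supNorm v :=
  Finset.le_sup (f := v) (Finset.mem_univ j)

theorem exists_eq_supNorm (hd : 0 < d) (v : Fin d → ℕ) : ∃ j, v j = supNorm v := by
  obtain ⟨j, -, hj⟩ := Finset.exists_mem_eq_sup (Finset.univ : Finset (Fin d))
    ⟨⟨0, hd⟩, Finset.mem_univ _⟩ v
  exact ⟨j, hj.symm⟩

theorem mem_box_iff {v : Fin d → ℕ} (hv : v ∈ posVec d) {N : ℕ} :
    v ∈ box d N ↔ supNorm v ≤ N := by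
  refine ⟨fun h => Finset.sup_le fun j _ => (h j).2, fun h j => ⟨hv j, (le_supNorm v j).trans h⟩⟩

theorem box_finite (d N : ℕ) : (box d N).Finite := by
  refine (Set.Finite.pi' (t := fun _ : Fin d => Set.Icc 1 N) fun _ => Set.finite_Icc 1 N).subset ?_
  intro v hv j
  exact hv j

theorem boxCount_mono (S : Set (Fin d → ℕ)) :
    Monotone fun N => ((S ∩ box d N).ncard : ℝ) := by
  intro M N h
  have : (S ∩ box d M).ncard ≤ (S ∩ box d N).ncard :=
    Set.ncard_le_ncard (Set.inter_subset_inter_right _ fun v hv j =>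
      ⟨(hv j).1, (hv j).2.trans h⟩) ((box_finite d N).inter_of_right _)
  exact Nat.cast_le.mpr this

/-- The logarithmic exponent β may have either sign, hence |β|. -/
theorem rpow_le_two_rpow_abs_mul {x y : ℝ} (hx : 0 < x) (hxy : x ≤ y) (hyx : y ≤ 2 * x) (β : ℝ) :
    y ^ β ≤ 2 ^ |β| * x ^ β := by
  have h1 : 1 ≤ y / x := (one_le_div hx).mpr hxy
  have h2 : y / x ≤ 2 := (div_le_iff₀ hx).mpr hyx
  have h3 : (y / x) ^ β ≤ 2 ^ |β| :=
    (Real.rpow_le_rpow_of_exponent_le h1 (le_abs_self β)).trans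
      (Real.rpow_le_rpow (by positivity) h2 (abs_nonneg β))
  rwa [Real.div_rpow (by linarith) hx.le, div_le_iff₀ (Real.rpow_pos_of_pos hx β)] at h3

theorem rpow_le_two_rpow_abs_mul' {x y : ℝ} (hx : 0 < x) (hxy : x ≤ y) (hyx : y ≤ 2 * x) (β : ℝ) :
    x ^ β ≤ 2 ^ |β| * y ^ β := by
  have hy := hx.trans_le hxy
  have h := rpow_le_two_rpow_abs_mul hx hxy hyx (-β)
  rw [abs_neg, Real.rpow_neg hx.le, Real.rpow_neg hy.le, ← div_eq_mul_inv, ← one_div,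
    div_le_div_iff₀ (Real.rpow_pos_of_pos hy β) (Real.rpow_pos_of_pos hx β), one_mul] at h
  exact h

theorem log_mul_bounds {b N : ℕ} (hb : 2 ≤ b) (hN : b ≤ N) :
    0 < Real.log N ∧ Real.log N ≤ Real.log (b * N : ℕ) ∧
      Real.log (b * N : ℕ) ≤ 2 * Real.log N := by
  have hb' : (2 : ℝ) ≤ b := by exact_mod_cast hb
  have hN' : (b : ℝ) ≤ N := by exact_mod_cast hN
  have h1 : 0 < Real.log b := Real.log_pos (by linarith)
  have h2 : Real.log b ≤ Real.log N := Real.log_le_log (by linarith) hN'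
  rw [Nat.cast_mul, Real.log_mul (by linarith) (by linarith)]
  refine ⟨?_, ?_, ?_⟩ <;> linarith

variable {S : Set (Fin d → ℕ)} {α : ℝ}

theorem HasPolyDensity.boxCount_mul_le (hS : HasPolyDensity S α) {b : ℕ} (hb : 2 ≤ b) :
    ∃ D : ℝ, 0 < D ∧ ∀ᶠ N : ℕ in atTop,
      ((S ∩ box d (b * N)).ncard : ℝ) ≤ D * ((S ∩ box d N).ncard : ℝ) := by
  obtain ⟨β, c, C, hc, hC, h⟩ := hS
  refine ⟨C / c * ((b : ℝ) ^ ((d : ℝ) / α) * 2 ^ |β|), by positivity, ?_⟩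
  filter_upwards [h, (tendsto_id.const_mul_atTop' (by omega : 0 < b)).eventually h,
    eventually_ge_atTop b] with N h1 h2 hN
  obtain ⟨l0, l1, l2⟩ := log_mul_bounds hb hN
  have hl := rpow_le_two_rpow_abs_mul' l0 l1 l2 β
  have p1 := Real.rpow_pos_of_pos l0 β
  have p2 := Real.rpow_pos_of_pos (l0.trans_le l1) β
  refine h2.2.trans ?_
  have e1 : (((b * N : ℕ) : ℝ) ^ ((d : ℝ) / α) / Real.log (b * N : ℕ) ^ β) ≤
      ((b : ℝ) ^ ((d : ℝ) / α) * 2 ^ |β|) * ((N : ℝ) ^ ((d : ℝ) / α) / Real.log N ^ β) := by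
    rw [div_le_iff₀ p2, Nat.cast_mul, Real.mul_rpow (by positivity) (by positivity)]
    calc (b : ℝ) ^ ((d : ℝ) / α) * (N : ℝ) ^ ((d : ℝ) / α)
        = (b : ℝ) ^ ((d : ℝ) / α) * ((N : ℝ) ^ ((d : ℝ) / α) / Real.log N ^ β) *
          Real.log N ^ β := by field_simp
      _ ≤ (b : ℝ) ^ ((d : ℝ) / α) * ((N : ℝ) ^ ((d : ℝ) / α) / Real.log N ^ β) *
          (2 ^ |β| * Real.log ((b * N : ℕ) : ℝ) ^ β) := by gcongr
      _ = _ := by push_cast; ring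
  calc C * (((b * N : ℕ) : ℝ) ^ ((d : ℝ) / α) / Real.log (b * N : ℕ) ^ β)
      ≤ C * (((b : ℝ) ^ ((d : ℝ) / α) * 2 ^ |β|) *
        ((N : ℝ) ^ ((d : ℝ) / α) / Real.log N ^ β)) := by gcongr
    _ = C / c * ((b : ℝ) ^ ((d : ℝ) / α) * 2 ^ |β|) *
        (c * ((N : ℝ) ^ ((d : ℝ) / α) / Real.log N ^ β)) := by field_simp
    _ ≤ _ := by gcongr; exact h1.1

theorem HasPolyDensity.two_mul_boxCount_le (hS : HasPolyDensity S α) (hδ : 0 < (d : ℝ) / α) :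
    ∃ b : ℕ, 2 ≤ b ∧ ∀ᶠ N : ℕ in atTop,
      2 * ((S ∩ box d N).ncard : ℝ) ≤ ((S ∩ box d (b * N)).ncard : ℝ) := by
  obtain ⟨β, c, C, hc, hC, h⟩ := hS
  -- b is taken so large that b^(d/α) outweighs the ratio C/c, the change of the logarithm, and the
  -- desired factor 2.
  have hbt : ∀ᶠ b : ℕ in atTop, 2 * C / c * 2 ^ |β| ≤ (b : ℝ) ^ ((d : ℝ) / α) :=
    ((tendsto_rpow_atTop hδ).comp tendsto_natCast_atTop_atTop).eventually_ge_atTop _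
  obtain ⟨b, hbb, hb⟩ := (hbt.and (eventually_ge_atTop 2)).exists
  refine ⟨b, hb, ?_⟩
  filter_upwards [h, (tendsto_id.const_mul_atTop' (by omega : 0 < b)).eventually h,
    eventually_ge_atTop b] with N h1 h2 hN
  obtain ⟨l0, l1, l2⟩ := log_mul_bounds hb hN
  have hl := rpow_le_two_rpow_abs_mul l0 l1 l2 β
  have p1 := Real.rpow_pos_of_pos l0 β
  have p2 := Real.rpow_pos_of_pos (l0.trans_le l1) β
  refine le_trans ?_ h2.1
  calc 2 * ((S ∩ box d N).ncard : ℝ)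
      ≤ 2 * (C * ((N : ℝ) ^ ((d : ℝ) / α) / Real.log N ^ β)) := by gcongr; exact h1.2
    _ ≤ c * (((b * N : ℕ) : ℝ) ^ ((d : ℝ) / α) / Real.log (b * N : ℕ) ^ β) := by
      rw [Nat.cast_mul b N, Real.mul_rpow (by positivity) (by positivity), ← Nat.cast_mul,
        ← mul_div_assoc c, le_div_iff₀ p2]
      calc 2 * (C * ((N : ℝ) ^ ((d : ℝ) / α) / Real.log N ^ β)) * Real.log ((b * N : ℕ) : ℝ) ^ β
          ≤ 2 * (C * ((N : ℝ) ^ ((d : ℝ) / α) / Real.log N ^ β)) *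
            (2 ^ |β| * Real.log N ^ β) := by gcongr
        _ = c * ((2 * C / c * 2 ^ |β|) * (N : ℝ) ^ ((d : ℝ) / α)) := by field_simp
        _ ≤ _ := by gcongr

theorem HasPolyDensity.le_boxCount (hS : HasPolyDensity S α) {ε : ℝ} (hε : 0 < ε) :
    ∃ c : ℝ, 0 < c ∧ ∀ᶠ N : ℕ in atTop,
      c * (N : ℝ) ^ ((d : ℝ) / α - ε) ≤ ((S ∩ box d N).ncard : ℝ) := by
  obtain ⟨β, c, C, hc, hC, h⟩ := hS
  refine ⟨c, hc, ?_⟩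
  have hlog := tendsto_natCast_atTop_atTop.eventually
    ((isLittleO_log_rpow_rpow_atTop β hε).bound one_pos)
  filter_upwards [h, hlog, eventually_ge_atTop 2] with N h1 h2 hN
  have hN' : (2 : ℝ) ≤ N := by exact_mod_cast hN
  have hl : 0 < Real.log N := Real.log_pos (by linarith)
  have hp := Real.rpow_pos_of_pos hl β
  rw [Real.norm_of_nonneg hp.le, Real.norm_of_nonneg (by positivity), one_mul] at h2
  refine le_trans ?_ h1.1
  rw [Real.rpow_sub (by linarith)]
  gcongr

theorem HasPolyDensity.boxCount_le (hS : HasPolyDensity S α) {ε : ℝ} (hε : 0 < ε)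
    (hδ : 0 < (d : ℝ) / α) :
    ∃ C : ℝ, 0 < C ∧ ∀ N : ℕ, 1 ≤ N →
      ((S ∩ box d N).ncard : ℝ) ≤ C * (N : ℝ) ^ ((d : ℝ) / α + ε) := by
  obtain ⟨β, c, C, hc, hC, h⟩ := hS
  have hlog := tendsto_natCast_atTop_atTop.eventually
    ((isLittleO_log_rpow_rpow_atTop (-β) hε).bound one_pos)
  obtain ⟨N₀, hN₀⟩ := eventually_atTop.mp (h.and (hlog.and (eventually_ge_atTop 2)))
  -- The second entry covers N ≤ N₀, where the power of N is at least 1.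
  refine ⟨max C ((S ∩ box d N₀).ncard : ℝ), by positivity, fun N hN => ?_⟩
  have h1N : (1 : ℝ) ≤ N := by exact_mod_cast hN
  rcases le_total N N₀ with hle | hle
  · have h1 : (1 : ℝ) ≤ (N : ℝ) ^ ((d : ℝ) / α + ε) := Real.one_le_rpow h1N (by positivity)
    calc ((S ∩ box d N).ncard : ℝ) ≤ ((S ∩ box d N₀).ncard : ℝ) := boxCount_mono S hle
      _ ≤ max C ((S ∩ box d N₀).ncard : ℝ) := le_max_right _ _
      _ ≤ _ := le_mul_of_one_le_right (by positivity) h1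
  · obtain ⟨h1, h2, h3⟩ := hN₀ N hle
    have hN' : (2 : ℝ) ≤ N := by exact_mod_cast h3
    have hl : 0 < Real.log N := Real.log_pos (by linarith)
    rw [Real.norm_of_nonneg (Real.rpow_nonneg hl.le _), Real.norm_of_nonneg (by positivity),
      one_mul, Real.rpow_neg hl.le] at h2
    refine h1.2.trans ?_
    rw [Real.rpow_add (by linarith), div_eq_mul_inv]
    have := Real.rpow_pos_of_pos hl β
    gcongr
    exact le_max_left _ _

theorem shell_ncard_le {S T : Set (Fin d → ℕ)} (hT : T ⊆ S) (hSpos : S ⊆ posVec d) (a b : ℝ) :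
    (shell T a b).Finite ∧ (shell T a b).ncard ≤ (S ∩ box d ⌊b⌋₊).ncard := by
  have hsub : shell T a b ⊆ S ∩ box d ⌊b⌋₊ := fun v hv =>
    ⟨hT hv.1, (mem_box_iff (hSpos (hT hv.1))).mpr (Nat.le_floor hv.2.2.le)⟩
  have hfin := (box_finite d ⌊b⌋₊).inter_of_right S
  exact ⟨hfin.subset hsub, Set.ncard_le_ncard hsub hfin⟩

theorem two_le_dist_of_supNorm_add_two_le (hd : 0 < d) {v w : Fin d → ℕ}
    (h : supNorm v + 2 ≤ supNorm w) : 2 ≤ dist v w := by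
  obtain ⟨j, hj⟩ := exists_eq_supNorm hd w
  have h1 : v j + 2 ≤ w j := by have := le_supNorm v j; omega
  have h2 : (v j : ℝ) + 2 ≤ w j := by exact_mod_cast h1
  refine le_trans ?_ (dist_le_pi_dist v w j)
  rw [Nat.dist_eq, abs_sub_comm]
  exact le_abs.mpr (Or.inl (by linarith))

/-- Distinct vectors with equal coordinate parities differ by at least 2 somewhere, and one of the
2^d parity classes holds its share of `U`. The exact cardinality serves both the density bound from
above and the dimension bound from below. -/
theorem exists_twoSeparated_subset (U : Finset (Fin d → ℕ)) {m : ℕ} (hm : m ≠ 0) :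
    ∃ T ⊆ U, TwoSeparated (T : Set (Fin d → ℕ)) ∧ T.card = ⌈(U.card : ℝ) / (2 ^ d * m)⌉₊ := by
  classical
  let f : (Fin d → ℕ) → Fin d → Bool := fun v j => decide (v j % 2 = 0)
  obtain ⟨y, -, hy⟩ := Finset.exists_le_card_fiber_of_nsmul_le_card_of_maps_to
    (s := U) (t := Finset.univ) (f := f) (b := (U.card : ℝ) / 2 ^ d)
    (fun _ _ => Finset.mem_univ _) Finset.univ_nonempty
    (by rw [Finset.card_univ, Fintype.card_fun, Fintype.card_bool, Fintype.card_fin, nsmul_eq_mul]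
        push_cast
        rw [mul_div_cancel₀ _ (by positivity)])
  have hle : ⌈(U.card : ℝ) / (2 ^ d * m)⌉₊ ≤ (U.filter fun v => f v = y).card := by
    refine Nat.ceil_le.mpr (le_trans ?_ hy)
    have : (1 : ℝ) ≤ m := by exact_mod_cast Nat.one_le_iff_ne_zero.mpr hm
    gcongr
    exact le_mul_of_one_le_right (by positivity) this
  obtain ⟨T, hT, hcard⟩ := Finset.exists_subset_card_eq hle
  refine ⟨T, hT.trans (Finset.filter_subset _ _), ?_, hcard⟩
  intro v hv w hw hvw
  have hf : f v = f w := (Finset.mem_filter.mp (hT hv)).2.trans (Finset.mem_filter.mp (hT hw)).2.symm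
  obtain ⟨j, hj⟩ := Function.ne_iff.mp hvw
  have hfj : (v j % 2 = 0) ↔ (w j % 2 = 0) := by simpa [f] using congrFun hf j
  refine le_trans ?_ (dist_le_pi_dist v w j)
  rw [Nat.dist_eq]
  rcases lt_or_gt_of_ne hj with h | h
  · have : v j + 2 ≤ w j := by omega
    have : (v j : ℝ) + 2 ≤ w j := by exact_mod_cast this
    exact le_abs.mpr (Or.inr (by linarith))
  · have : w j + 2 ≤ v j := by omega
    have : (w j : ℝ) + 2 ≤ v j := by exact_mod_cast this
    exact le_abs.mpr (Or.inl (by linarith))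

end Counting

/-! ### A sparse separated subset with many elements in every shell -/

section Thinning

variable {d : ℕ} {S : Set (Fin d → ℕ)} {α : ℝ}

/-- The elements of `S` with sup norm in `(b ^ (2 * k), b ^ (2 * k + 1)]`. -/
def annulus (S : Set (Fin d → ℕ)) (b k : ℕ) : Set (Fin d → ℕ) :=
  (S ∩ box d (b ^ (2 * k + 1))) \ (S ∩ box d (b ^ (2 * k)))

theorem annulus_finite (S : Set (Fin d → ℕ)) (b k : ℕ) : (annulus S b k).Finite :=
  ((box_finite d _).inter_of_right S).sdiff

theorem mem_annulus (hSpos : S ⊆ posVec d) {b k : ℕ} {v : Fin d → ℕ} (hv : v ∈ annulus S b k) :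
    v ∈ S ∧ b ^ (2 * k) < supNorm v ∧ supNorm v ≤ b ^ (2 * k + 1) := by
  obtain ⟨⟨h1, h2⟩, h3⟩ := hv
  refine ⟨h1, ?_, (mem_box_iff (hSpos h1)).mp h2⟩
  by_contra! h
  exact h3 ⟨h1, (mem_box_iff (hSpos h1)).mpr h⟩

theorem annulus_ncard {b : ℕ} (hb : 2 ≤ b) (k : ℕ) :
    ((annulus S b k).ncard : ℝ) =
      (S ∩ box d (b ^ (2 * k + 1))).ncard - (S ∩ box d (b ^ (2 * k))).ncard := by
  have hsub : S ∩ box d (b ^ (2 * k)) ⊆ S ∩ box d (b ^ (2 * k + 1)) :=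
    Set.inter_subset_inter_right _ fun v hv j =>
      ⟨(hv j).1, (hv j).2.trans (Nat.pow_le_pow_right (by omega) (by omega))⟩
  have hfin := (box_finite d (b ^ (2 * k + 1))).inter_of_right S
  have := Set.ncard_sdiff_add_ncard_of_subset hsub hfin
  rw [annulus, eq_sub_iff_add_eq]
  exact_mod_cast this

theorem sum_annulus_le {b : ℕ} (hb : 2 ≤ b) (k : ℕ) :
    ∑ i ∈ Finset.range (k + 1), ((annulus S b i).ncard : ℝ) ≤
      (S ∩ box d (b ^ (2 * k + 1))).ncard := by
  induction k with
  | zero =>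
    rw [zero_add, Finset.sum_range_one, annulus_ncard hb]
    linarith [Nat.cast_nonneg (α := ℝ) (S ∩ box d (b ^ (2 * 0))).ncard]
  | succ k ih =>
    rw [Finset.sum_range_succ, annulus_ncard hb]
    have : ((S ∩ box d (b ^ (2 * k + 1))).ncard : ℝ) ≤ (S ∩ box d (b ^ (2 * (k + 1)))).ncard :=
      boxCount_mono S (Nat.pow_le_pow_right (by omega) (by omega))
    linarith

theorem HasPolyDensity.boxCount_tendsto (hS : HasPolyDensity S α) (hδ : 0 < (d : ℝ) / α) :
    Tendsto (fun N => ((S ∩ box d N).ncard : ℝ)) atTop atTop := by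
  obtain ⟨c, hc, h⟩ := hS.le_boxCount (half_pos hδ)
  refine tendsto_atTop_mono' _ h (Tendsto.const_mul_atTop hc ?_)
  exact (tendsto_rpow_atTop (by linarith)).comp tendsto_natCast_atTop_atTop

/-- The omitted annuli (b^(2k+1), b^(2k+2)] keep different blocks apart in norm. -/
theorem iUnion_twoSeparated (hd : 0 < d) {b : ℕ} (hb : 2 ≤ b) (hSpos : S ⊆ posVec d)
    {T : ℕ → Finset (Fin d → ℕ)} (hT : ∀ k, (T k : Set (Fin d → ℕ)) ⊆ annulus S b k)
    (hsep : ∀ k, TwoSeparated (T k : Set (Fin d → ℕ))) :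
    TwoSeparated (⋃ k, (T k : Set (Fin d → ℕ))) := by
  have hlt : ∀ {i k : ℕ} {v w : Fin d → ℕ}, v ∈ (T i : Set (Fin d → ℕ)) →
      w ∈ (T k : Set (Fin d → ℕ)) → i < k → 2 ≤ dist v w := by
    intro i k v w hv hw hik
    refine two_le_dist_of_supNorm_add_two_le hd ?_
    have h1 := (mem_annulus hSpos (hT i hv)).2.2
    have h2 := (mem_annulus hSpos (hT k hw)).2.1
    have h3 : b ^ (2 * i + 2) ≤ b ^ (2 * k) := Nat.pow_le_pow_right (by omega) (by omega)
    have h4 : b ^ (2 * i + 2) = b ^ (2 * i + 1) * b := pow_succ _ _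
    have h5 : 1 ≤ b ^ (2 * i + 1) := Nat.one_le_pow _ _ (by omega)
    nlinarith
  intro v hv w hw hvw
  obtain ⟨i, hi⟩ := Set.mem_iUnion.mp hv
  obtain ⟨k, hk⟩ := Set.mem_iUnion.mp hw
  rcases lt_trichotomy i k with h | rfl | h
  · exact hlt hi hk h
  · exact hsep i hi hk hvw
  · rw [dist_comm]; exact hlt hk hi h

/-- Block sizes are little-o of annulus sizes, and this passes to partial sums because the latter
diverge. The annuli up to k fit in the box of side b^(2k+1), whose count is at most a constant times
that of side b^(2k). -/
theorem relUpperDensity_iUnion_eq_zero (hSpos : S ⊆ posVec d) (hS : HasPolyDensity S α)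
    (hδ : 0 < (d : ℝ) / α) {b : ℕ} (hb : 2 ≤ b)
    (hdouble : ∀ᶠ N : ℕ in atTop,
      2 * ((S ∩ box d N).ncard : ℝ) ≤ ((S ∩ box d (b * N)).ncard : ℝ))
    {T : ℕ → Finset (Fin d → ℕ)} (hT : ∀ k, (T k : Set (Fin d → ℕ)) ⊆ annulus S b k)
    (hcard : ∀ k, ((T k).card : ℝ) ≤ (annulus S b k).ncard / ((k : ℝ) + 1) + 1) :
    relUpperDensity (⋃ k, (T k : Set (Fin d → ℕ))) S = 0 := by
  obtain ⟨D, hD, hDle⟩ := hS.boxCount_mul_le hb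
  have hpow : Tendsto (fun k : ℕ => b ^ (2 * k)) atTop atTop :=
    (tendsto_pow_atTop_atTop_of_one_lt (by omega : 1 < b)).comp
      (tendsto_id.const_mul_atTop' two_pos)
  have hann : Tendsto (fun k => ((annulus S b k).ncard : ℝ)) atTop atTop := by
    refine tendsto_atTop_mono' _ ?_ ((hS.boxCount_tendsto hδ).comp hpow)
    filter_upwards [hpow.eventually hdouble] with k hk
    rw [annulus_ncard hb, pow_succ, mul_comm _ b, Function.comp_apply]
    linarith
  have hlittle : (fun k => ((T k).card : ℝ)) =o[atTop] fun k => ((annulus S b k).ncard : ℝ) := by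
    refine Asymptotics.isLittleO_iff.mpr fun c hc => ?_
    have h1 : ∀ᶠ k : ℕ in atTop, 1 / ((k : ℝ) + 1) ≤ c / 2 :=
      tendsto_one_div_add_atTop_nhds_zero_nat.eventually_le_const (by positivity)
    filter_upwards [h1, hann.eventually_ge_atTop (2 / c)] with k hk1 hk2
    rw [Real.norm_of_nonneg (by positivity), Real.norm_of_nonneg (by positivity)]
    have h2 : 1 ≤ c / 2 * (annulus S b k).ncard := by
      rw [div_le_iff₀ hc] at hk2; linarith
    have h3 : ((annulus S b k).ncard : ℝ) / ((k : ℝ) + 1) ≤ c / 2 * (annulus S b k).ncard := by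
      rw [div_eq_mul_one_div, mul_comm]; gcongr
    linarith [hcard k]
  have hsumtend : Tendsto (fun n => ∑ i ∈ Finset.range n, ((annulus S b i).ncard : ℝ))
      atTop atTop := by
    rw [← tendsto_add_atTop_iff_nat 1]
    refine tendsto_atTop_mono (fun n => ?_) hann
    exact Finset.single_le_sum (f := fun i => ((annulus S b i).ncard : ℝ))
      (fun i _ => Nat.cast_nonneg _) (Finset.self_mem_range_succ n)
  have hsum := hlittle.sum_range (fun i => Nat.cast_nonneg _) hsumtend
  refine Tendsto.limsup_eq ?_
  have hlog : Tendsto (fun N => Nat.log (b ^ 2) N) atTop atTop :=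
    tendsto_atTop_atTop.mpr fun k => ⟨(b ^ 2) ^ k, fun N hN =>
      Nat.le_log_of_pow_le (Nat.one_lt_pow two_ne_zero (by omega)) hN⟩
  -- The index k = `Nat.log (b ^ 2) N` satisfies b^(2k) ≤ N < b^(2k+2), so only the blocks 0, …, k
  -- meet the box.
  refine squeeze_zero_norm' (a := fun N => (∑ i ∈ Finset.range (Nat.log (b ^ 2) N + 1),
    ((T i).card : ℝ)) / ((S ∩ box d (b ^ (2 * Nat.log (b ^ 2) N))).ncard : ℝ)) ?_ ?_
  · filter_upwards [eventually_ge_atTop 1,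
      hlog.eventually (hpow.eventually ((hS.boxCount_tendsto hδ).eventually_gt_atTop 0))]
      with N hN hpos
    rw [Real.norm_of_nonneg (by positivity)]
    have hle : b ^ (2 * Nat.log (b ^ 2) N) ≤ N := by
      rw [pow_mul]; exact Nat.pow_log_le_self _ (by omega)
    have hlt : N < b ^ (2 * (Nat.log (b ^ 2) N + 1)) := by
      rw [pow_mul]; exact Nat.lt_pow_succ_log_self (Nat.one_lt_pow two_ne_zero (by omega)) _
    have hnum : ((⋃ k, (T k : Set (Fin d → ℕ))) ∩ box d N).ncard ≤
        ∑ i ∈ Finset.range (Nat.log (b ^ 2) N + 1), (T i).card := by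
      classical
      refine le_trans ?_ Finset.card_biUnion_le
      rw [← Set.ncard_coe_finset]
      refine Set.ncard_le_ncard ?_ (Finset.finite_toSet _)
      rintro v ⟨hv, hvN⟩
      obtain ⟨i, hi⟩ := Set.mem_iUnion.mp hv
      have h1 := mem_annulus hSpos (hT i hi)
      have h2 := (mem_box_iff (hSpos h1.1)).mp hvN
      refine Finset.mem_coe.mpr (Finset.mem_biUnion.mpr ⟨i, Finset.mem_range.mpr ?_, hi⟩)
      by_contra! hcon
      have h3 : b ^ (2 * (Nat.log (b ^ 2) N + 1)) ≤ b ^ (2 * i) :=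
        Nat.pow_le_pow_right (by omega) (by omega)
      omega
    have hnum' : (((⋃ k, (T k : Set (Fin d → ℕ))) ∩ box d N).ncard : ℝ) ≤
        ∑ i ∈ Finset.range (Nat.log (b ^ 2) N + 1), ((T i).card : ℝ) := by exact_mod_cast hnum
    have hden : ((S ∩ box d (b ^ (2 * Nat.log (b ^ 2) N))).ncard : ℝ) ≤ (S ∩ box d N).ncard :=
      boxCount_mono S hle
    exact div_le_div₀ (Finset.sum_nonneg fun i _ => Nat.cast_nonneg _) hnum' hpos hden
  · refine Tendsto.comp (g := fun k => (∑ i ∈ Finset.range (k + 1),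
      ((T i).card : ℝ)) / ((S ∩ box d (b ^ (2 * k))).ncard : ℝ)) ?_ hlog
    have hO : (fun k => ∑ i ∈ Finset.range (k + 1), ((annulus S b i).ncard : ℝ)) =O[atTop]
        fun k => ((S ∩ box d (b ^ (2 * k))).ncard : ℝ) := by
      refine Asymptotics.IsBigO.of_bound D ?_
      filter_upwards [hpow.eventually hDle] with k hk
      rw [Real.norm_of_nonneg (Finset.sum_nonneg fun i _ => Nat.cast_nonneg _),
        Real.norm_of_nonneg (Nat.cast_nonneg _)]
      refine (sum_annulus_le hb k).trans ?_
      rwa [pow_succ, mul_comm _ b]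
    exact ((hsum.comp_tendsto (tendsto_add_atTop_nat 1)).trans_isBigO hO).tendsto_div_nhds_zero

/-- The thinning factor k + 1 is logarithmic in the norm b^(2k), hence cheaper than any power. -/
theorem exists_mul_add_one_le_rpow {b : ℕ} (hb : 2 ≤ b) {ε : ℝ} (hε : 0 < ε) :
    ∃ κ : ℝ, 0 < κ ∧ ∀ k : ℕ, κ * ((k : ℝ) + 1) ≤ ((b : ℝ) ^ (2 * k)) ^ ε := by
  have hb' : (2 : ℝ) ≤ b := by exact_mod_cast hb
  have hlog : 0 < Real.log b := Real.log_pos (by linarith)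
  refine ⟨min 1 (2 * Real.log b * ε), by positivity, fun k => ?_⟩
  have h1 : ((b : ℝ) ^ (2 * k)) ^ ε = Real.exp (2 * Real.log b * ε * k) := by
    rw [Real.rpow_def_of_pos (by positivity), Real.log_pow]
    push_cast; ring_nf
  rw [h1, mul_add, mul_one]
  refine le_trans ?_ (Real.add_one_le_exp _)
  gcongr
  · exact min_le_right _ _
  · exact min_le_left _ _

theorem exists_thin_subset (hd : 0 < d) (hSpos : S ⊆ posVec d) (hS : HasPolyDensity S α)
    (hδ : 0 < (d : ℝ) / α) :
    ∃ T ⊆ S, relUpperDensity T S = 0 ∧ TwoSeparated T ∧ T.Infinite ∧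
      ∃ L t₀ : ℝ, 1 < L ∧ L < t₀ ∧ (∀ M ≥ t₀, (shell T M (L * M)).Nonempty) ∧
        ∀ ε, 0 < ε → ε < (d : ℝ) / α → ∃ c > 0, ∀ M ≥ t₀,
          c * M ^ ((d : ℝ) / α - ε) ≤ (shell T M (L * M)).ncard := by
  obtain ⟨b, hb, hdouble⟩ := hS.two_mul_boxCount_le hδ
  have hb' : (2 : ℝ) ≤ b := by exact_mod_cast hb
  have hpow : Tendsto (fun k : ℕ => b ^ (2 * k)) atTop atTop :=
    (tendsto_pow_atTop_atTop_of_one_lt (by omega : 1 < b)).comp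
      (tendsto_id.const_mul_atTop' two_pos)
  choose T hTsub hTsep hTcard using fun k : ℕ =>
    exists_twoSeparated_subset (annulus_finite S b k).toFinset (Nat.succ_ne_zero k)
  have hT : ∀ k, (T k : Set (Fin d → ℕ)) ⊆ annulus S b k := fun k v hv =>
    (annulus_finite S b k).mem_toFinset.mp (hTsub k hv)
  have hcard : ∀ k, (T k).card = ⌈((annulus S b k).ncard : ℝ) / (2 ^ d * ((k : ℝ) + 1))⌉₊ := by
    intro k
    rw [hTcard, Set.ncard_eq_toFinset_card _ (annulus_finite S b k), Nat.cast_succ]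
  -- By the choice of b, an annulus eventually has at least as many points as the box inside it.
  have hcard_ge : ∀ᶠ k : ℕ in atTop,
      ((S ∩ box d (b ^ (2 * k))).ncard : ℝ) / (2 ^ d * ((k : ℝ) + 1)) ≤ (T k).card := by
    filter_upwards [hpow.eventually hdouble] with k hk
    rw [hcard]
    refine le_trans ?_ (Nat.le_ceil _)
    refine div_le_div_of_nonneg_right ?_ (by positivity)
    rw [annulus_ncard hb, pow_succ, mul_comm _ b]
    linarith
  have hcard_pos : ∀ᶠ k : ℕ in atTop, (T k).Nonempty := by
    filter_upwards [hcard_ge,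
      hpow.eventually ((hS.boxCount_tendsto hδ).eventually_gt_atTop 0)] with k h1 h2
    have : (0 : ℝ) < (T k).card := lt_of_lt_of_le (by positivity) h1
    exact Finset.card_pos.mp (by exact_mod_cast this)
  obtain ⟨k₁, hk₁⟩ := eventually_atTop.mp hcard_pos
  have hTS : (⋃ k, (T k : Set (Fin d → ℕ))) ⊆ S := Set.iUnion_subset fun k v hv => (hT k hv).1.1
  -- If b^(2n) ≤ M < b^(2n+2), then block n + 1 starts above M and ends at b^(2n+3) ≤ b^3 M < b^4 M.
  set L : ℝ := (b : ℝ) ^ 4 with hL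
  have hL1 : 1 < L := one_lt_pow₀ (by linarith) (by norm_num)
  -- every shell contains one of the blocks
  have hblock : ∀ M : ℝ, 1 ≤ M → ∃ k : ℕ, M ≤ (b : ℝ) ^ (2 * k) ∧
      (T k : Set (Fin d → ℕ)) ⊆ shell (⋃ k, (T k : Set (Fin d → ℕ))) M (L * M) := by
    intro M hM
    obtain ⟨n, hn1, hn2⟩ := exists_nat_pow_near hM (one_lt_pow₀ (by linarith : (1 : ℝ) < b)
      two_ne_zero)
    rw [← pow_mul] at hn1 hn2
    refine ⟨n + 1, hn2.le, fun v hv => ?_⟩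
    obtain ⟨h1, h2, h3⟩ := mem_annulus hSpos (hT _ hv)
    have h2' : (b : ℝ) ^ (2 * (n + 1)) < supNorm v := by exact_mod_cast h2
    have h3' : (supNorm v : ℝ) ≤ (b : ℝ) ^ (2 * (n + 1) + 1) := by exact_mod_cast h3
    refine ⟨Set.mem_iUnion.mpr ⟨_, hv⟩, hn2.le.trans h2'.le, ?_⟩
    calc (supNorm v : ℝ) ≤ (b : ℝ) ^ (2 * (n + 1) + 1) := h3'
      _ = b ^ 3 * b ^ (2 * n) := by ring
      _ ≤ b ^ 3 * M := by gcongr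
      _ < L * M := by
        have : (b : ℝ) ^ 3 < b ^ 4 := pow_lt_pow_right₀ (by linarith) (by norm_num)
        gcongr
  have hfin : ∀ M, (shell (⋃ k, (T k : Set (Fin d → ℕ))) M (L * M)).Finite := fun M =>
    (shell_ncard_le hTS hSpos M (L * M)).1
  -- The second entry forces the block inside the shell to have index at least `k₁`, so that it is
  -- nonempty.
  set t₀ : ℝ := max (L + 1) ((b : ℝ) ^ (2 * k₁) + 1) with ht₀
  have ht₀1 : L < t₀ := (lt_add_one L).trans_le (le_max_left _ _)
  have hlarge : ∀ (k₂ k : ℕ) (M : ℝ), (b : ℝ) ^ (2 * k₂) ≤ M → M ≤ (b : ℝ) ^ (2 * k) →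
      k₂ ≤ k := by
    intro k₂ k M h1 h2
    have := (pow_le_pow_iff_right₀ (by linarith : (1 : ℝ) < b)).mp (h1.trans h2)
    omega
  have hne : ∀ M ≥ t₀, (shell (⋃ k, (T k : Set (Fin d → ℕ))) M (L * M)).Nonempty := by
    intro M hM
    obtain ⟨k, hk, hsub⟩ := hblock M (by linarith)
    have hk₁M : (b : ℝ) ^ (2 * k₁) + 1 ≤ M := (le_max_right _ _).trans hM
    obtain ⟨v, hv⟩ := hk₁ k (hlarge k₁ k M (by linarith) hk)
    exact ⟨v, hsub hv⟩
  refine ⟨⋃ k, (T k : Set (Fin d → ℕ)), hTS, ?_, iUnion_twoSeparated hd hb hSpos hT hTsep, ?_,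
    L, t₀, hL1, ht₀1, hne, ?_⟩
  · refine relUpperDensity_iUnion_eq_zero hSpos hS hδ hb hdouble hT fun k => ?_
    rw [hcard]
    refine (Nat.ceil_lt_add_one (by positivity)).le.trans ?_
    gcongr
    exact le_mul_of_one_le_left (by positivity) (one_le_pow₀ one_le_two)
  · refine Set.Infinite.of_image supNorm (Set.infinite_of_forall_exists_gt fun a => ?_)
    obtain ⟨v, hv, hv1, -⟩ := hne (max t₀ (a + 1)) (le_max_left _ _)
    refine ⟨supNorm v, ⟨v, hv, rfl⟩, ?_⟩
    have : (a : ℝ) + 1 ≤ supNorm v := (le_max_right _ _).trans hv1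
    have : (a : ℝ) < supNorm v := by linarith
    exact_mod_cast this
  · intro ε hε hεδ
    obtain ⟨c, hc, hcle⟩ := hS.le_boxCount (half_pos hε)
    obtain ⟨κ, hκ, hκle⟩ := exists_mul_add_one_le_rpow hb (half_pos hε)
    obtain ⟨k₂, hk₂⟩ := eventually_atTop.mp (hcard_ge.and (hpow.eventually hcle))
    set e : ℝ := (d : ℝ) / α - ε with he
    have he0 : 0 < e := by linarith
    -- The second entry handles M ≤ b^(2 k₂), where the shell is only known to be nonempty.
    refine ⟨min (c * κ / 2 ^ d) (((b : ℝ) ^ (2 * k₂)) ^ e)⁻¹, by positivity, fun M hM => ?_⟩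
    have hM1 : 1 ≤ M := by linarith
    rcases le_total M ((b : ℝ) ^ (2 * k₂)) with hMk | hMk
    · have h1 : 1 ≤ (shell (⋃ k, (T k : Set (Fin d → ℕ))) M (L * M)).ncard :=
        (Set.ncard_pos (hfin M)).mpr (hne M hM)
      have h1' : (1 : ℝ) ≤ (shell (⋃ k, (T k : Set (Fin d → ℕ))) M (L * M)).ncard := by
        exact_mod_cast h1
      refine le_trans ?_ h1'
      calc _ ≤ (((b : ℝ) ^ (2 * k₂)) ^ e)⁻¹ * ((b : ℝ) ^ (2 * k₂)) ^ e := by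
            gcongr; exact min_le_right _ _
        _ = 1 := inv_mul_cancel₀ (by positivity)
    · obtain ⟨k, hk, hsub⟩ := hblock M hM1
      obtain ⟨h1, h2⟩ := hk₂ k (hlarge k₂ k M hMk hk)
      have h3 : ((T k).card : ℝ) ≤ (shell (⋃ k, (T k : Set (Fin d → ℕ))) M (L * M)).ncard := by
        rw [← Set.ncard_coe_finset]
        exact_mod_cast Set.ncard_le_ncard hsub (hfin M)
      refine le_trans ?_ (h1.trans h3)
      push_cast at h2
      set X : ℝ := (b : ℝ) ^ (2 * k) with hX
      have hX0 : 0 < X := by positivity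
      calc _ ≤ c * κ / 2 ^ d * X ^ e := by
            gcongr; exact min_le_left _ _
        _ = c * κ * X ^ e / 2 ^ d := by ring
        _ ≤ c * (X ^ (ε / 2) / ((k : ℝ) + 1)) * X ^ e / 2 ^ d := by
            have : κ ≤ X ^ (ε / 2) / ((k : ℝ) + 1) := by
              rw [le_div_iff₀ (by positivity)]; exact hκle k
            gcongr
        _ = c * X ^ ((d : ℝ) / α - ε / 2) / (2 ^ d * ((k : ℝ) + 1)) := by
            rw [show (d : ℝ) / α - ε / 2 = ε / 2 + e by rw [he]; ring, Real.rpow_add hX0]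
            field_simp
        _ ≤ _ := by gcongr

end Thinning

/-! ### Dimension of sets of points with restricted digits: lower bound -/

/-- The hypothesis makes `g` injective on `s` with an inverse that is Hölder of exponent r; `g`
itself need not be continuous. -/
theorem mul_dimH_le_dimH_image {X Y : Type*} [EMetricSpace X] [EMetricSpace Y] {g : X → Y}
    {s : Set X} {C r : NNReal} (hr : 0 < r)
    (h : ∀ x ∈ s, ∀ y ∈ s, edist x y ≤ C * edist (g x) (g y) ^ (r : ℝ)) :
    r * dimH s ≤ dimH (g '' s) := by
  rcases s.eq_empty_or_nonempty with rfl | ⟨x₀, hx₀⟩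
  · simp
  have : Nonempty X := ⟨x₀⟩
  have hmem : ∀ x ∈ g '' s, Function.invFunOn g s x ∈ s := fun x hx => Function.invFunOn_mem hx
  have heq : ∀ x ∈ g '' s, g (Function.invFunOn g s x) = x := fun x hx => Function.invFunOn_eq hx
  have hold : HolderOnWith C r (Function.invFunOn g s) (g '' s) := by
    intro x hx y hy
    have := h _ (hmem x hx) _ (hmem y hy)
    rwa [heq x hx, heq y hy] at this
  have himg : Function.invFunOn g s '' (g '' s) = s := by
    apply Set.Subset.antisymm
    · rintro _ ⟨x, hx, rfl⟩; exact hmem x hx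
    · intro x hx
      refine ⟨g x, ⟨x, hx, rfl⟩, ?_⟩
      have := h _ (hmem (g x) ⟨x, hx, rfl⟩) x hx
      rw [heq (g x) ⟨x, hx, rfl⟩, edist_self, ENNReal.zero_rpow_of_pos (by exact_mod_cast hr),
        mul_zero] at this
      exact edist_le_zero.mp this
  have := hold.dimH_image_le hr
  rw [himg] at this
  calc (r : ENNReal) * dimH s ≤ r * (dimH (g '' s) / r) := by gcongr
    _ ≤ dimH (g '' s) := ENNReal.mul_div_le

/-- The `n`-th remainder in the mixed radix expansion with radices `N 0, N 1, …`. -/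
def mixedRem (N : ℕ → ℕ) (y : ℝ) : ℕ → ℝ
  | 0 => y
  | n + 1 => Int.fract (N n * mixedRem N y n)

/-- The `n`-th digit in the mixed radix expansion with radices `N 0, N 1, …`. -/
def mixedDigit (N : ℕ → ℕ) (y : ℝ) (n : ℕ) : ℕ := ⌊N n * mixedRem N y n⌋₊

theorem mixedRem_mem (N : ℕ → ℕ) {y : ℝ} (hy : y ∈ Set.Ico (0 : ℝ) 1) (n : ℕ) :
    mixedRem N y n ∈ Set.Ico (0 : ℝ) 1 := by
  cases n with
  | zero => exact hy
  | succ n => exact ⟨Int.fract_nonneg _, Int.fract_lt_one _⟩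

theorem mixedDigit_lt {N : ℕ → ℕ} (hN : ∀ n, 0 < N n) {y : ℝ} (hy : y ∈ Set.Ico (0 : ℝ) 1)
    (n : ℕ) : mixedDigit N y n < N n := by
  obtain ⟨h0, h1⟩ := mixedRem_mem N hy n
  have : (0 : ℝ) < N n := by exact_mod_cast hN n
  rw [mixedDigit, Nat.floor_lt (by positivity)]
  nlinarith

theorem mul_mixedRem (N : ℕ → ℕ) {y : ℝ} (hy : y ∈ Set.Ico (0 : ℝ) 1) (n : ℕ) :
    N n * mixedRem N y n = mixedDigit N y n + mixedRem N y (n + 1) := by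
  have h0 := (mixedRem_mem N hy n).1
  rw [mixedDigit, natCast_floor_eq_intCast_floor (by positivity), mixedRem, Int.floor_add_fract]

/-- Equal digits cancel, so multiplying y - z by the radices leaves the difference of two remainders
in [0,1). -/
theorem abs_sub_le_of_mixedDigit_eq {N : ℕ → ℕ} (hN : ∀ n, 0 < N n) {y z : ℝ}
    (hy : y ∈ Set.Ico (0 : ℝ) 1) (hz : z ∈ Set.Ico (0 : ℝ) 1) {n : ℕ}
    (h : ∀ i < n, mixedDigit N y i = mixedDigit N z i) :
    |y - z| ≤ (∏ i ∈ Finset.range n, (N i : ℝ))⁻¹ := by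
  have key : (∏ i ∈ Finset.range n, (N i : ℝ)) * (y - z) = mixedRem N y n - mixedRem N z n := by
    induction n with
    | zero => simp [mixedRem]
    | succ n ih =>
      rw [Finset.prod_range_succ, mul_comm _ (N n : ℝ), mul_assoc,
        ih fun i hi => h i (by omega), mul_sub, mul_mixedRem N hy, mul_mixedRem N hz,
        h n (Nat.lt_succ_self n)]
      ring
  have hpos : 0 < ∏ i ∈ Finset.range n, (N i : ℝ) :=
    Finset.prod_pos fun i _ => by exact_mod_cast hN i
  obtain ⟨h1, h2⟩ := mixedRem_mem N hy n
  obtain ⟨h3, h4⟩ := mixedRem_mem N hz n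
  rw [← mul_one (_)⁻¹, le_inv_mul_iff₀ hpos]
  rw [← abs_of_pos hpos, ← abs_mul, key, abs_le]
  constructor <;> linarith

/-- If the `n`-th digit vector ranges freely over a `2`-separated set of `|A n|` vectors bounded by
`B n - 1`, then the dimension is at least `s` as soon as `∏ |A i|` dominates `(∏ B i ^ 2) ^ s`. -/
theorem le_dimH_of_branching {d : ℕ} (A : ℕ → Finset (Fin d → ℕ)) (B : ℕ → ℝ)
    (hne : ∀ n, (A n).Nonempty) (hpos : ∀ n, ∀ v ∈ A n, v ∈ posVec d)
    (hsep : ∀ n, TwoSeparated (A n : Set (Fin d → ℕ)))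
    (hB : ∀ n, ∀ v ∈ A n, ∀ j, (v j : ℝ) + 1 ≤ B n) {s C : NNReal} (hs : 0 < s)
    (htend : Tendsto (fun n => ∏ i ∈ Finset.range n, ((A i).card : ℝ)) atTop atTop)
    (hC : ∀ n, (∏ i ∈ Finset.range n, ((A i).card : ℝ))⁻¹ ≤
      C * (∏ i ∈ Finset.range (n + 1), 1 / B i ^ 2) ^ (s : ℝ)) :
    (s : ENNReal) ≤ dimH {x ∈ irrCube d | ∀ n, digitVec x n ∈ A n} := by
  set N : ℕ → ℕ := fun n => (A n).card
  have hN : ∀ n, 0 < N n := fun n => (hne n).card_pos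
  -- The n-th mixed radix digit of y selects an element of `A n` through an enumeration. Outside
  -- [0,1) the value is arbitrary.
  have hex : ∀ y : ℝ, ∃ x ∈ irrCube d, ∀ h : y ∈ Set.Ico (0 : ℝ) 1, ∀ n,
      digitVec x n = ((A n).equivFin.symm ⟨mixedDigit N y n, mixedDigit_lt hN h n⟩ : Fin d → ℕ) := by
    intro y
    by_cases h : y ∈ Set.Ico (0 : ℝ) 1
    · obtain ⟨x, hx, hxa⟩ := exists_digitVec_eq (a := fun n =>
        ((A n).equivFin.symm ⟨mixedDigit N y n, mixedDigit_lt hN h n⟩ : Fin d → ℕ))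
        (fun n => hpos n _ (Subtype.coe_prop _))
      exact ⟨x, hx, fun _ => hxa⟩
    · obtain ⟨x, hx, -⟩ := exists_digitVec_eq (d := d) (a := fun _ _ => 1) (fun _ _ => le_rfl)
      exact ⟨x, hx, fun h' => absurd h' h⟩
  choose g hg hgd using hex
  have hanti : ∀ y ∈ Set.Ico (0 : ℝ) 1, ∀ z ∈ Set.Ico (0 : ℝ) 1,
      edist y z ≤ C * edist (g y) (g z) ^ (s : ℝ) := by
    intro y hy z hz
    by_cases hyz : y = z
    · simp [hyz]
    have hdiff : ∃ n, mixedDigit N y n ≠ mixedDigit N z n := by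
      by_contra! hcon
      have hle : |y - z| ≤ 0 := ge_of_tendsto' htend.inv_tendsto_atTop
        fun n => abs_sub_le_of_mixedDigit_eq hN hy hz (n := n) fun i _ => hcon i
      exact hyz (sub_eq_zero.mp (abs_nonpos_iff.mp hle))
    classical
    set n := Nat.find hdiff
    have hn : mixedDigit N y n ≠ mixedDigit N z n := Nat.find_spec hdiff
    have hlt : ∀ i < n, mixedDigit N y i = mixedDigit N z i := fun i hi =>
      not_not.mp (Nat.find_min hdiff hi)
    have hvlt : ∀ i < n, digitVec (g y) i = digitVec (g z) i := fun i hi => by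
      rw [hgd y hy, hgd z hz]; simp only [hlt i hi]
    have hvn : digitVec (g y) n ≠ digitVec (g z) n := by
      rw [hgd y hy, hgd z hz]
      intro h
      have := (A n).equivFin.symm.injective (Subtype.ext h)
      exact hn (by simpa using this)
    have hmem : ∀ w ∈ Set.Ico (0 : ℝ) 1, ∀ i, digitVec (g w) i ∈ A i := fun w hw i => by
      rw [hgd w hw]; exact Subtype.coe_prop _
    have hdist := hsep n (hmem y hy n) (hmem z hz n) hvn
    obtain ⟨j, hj⟩ : ∃ j, 2 ≤ dist (digitVec (g y) n j) (digitVec (g z) n j) := by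
      by_contra! hcon
      exact absurd hdist (not_le.mpr ((dist_pi_lt_iff two_pos).mpr hcon))
    rw [Nat.dist_eq] at hj
    have h1 := prod_le_abs_sub_of_digit_separated B n (hg y j) (hg z j)
      (fun i _ => hB i _ (hmem y hy i) j) (fun i _ => hB i _ (hmem z hz i) j)
      (fun i hi => congrFun (hvlt i hi) j) hj
    have h2 : ∏ i ∈ Finset.range (n + 1), 1 / B i ^ 2 ≤ dist (g y) (g z) :=
      h1.trans (dist_le_pi_dist (g y) (g z) j)
    -- Agreement before n bounds |y - z| by a product over i < n, whereas the gap between the images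
    -- also involves digit n; hence the shifted ranges in `hC`.
    have h3 : dist y z ≤ C * dist (g y) (g z) ^ (s : ℝ) := by
      refine (abs_sub_le_of_mixedDigit_eq hN hy hz hlt).trans ((hC n).trans ?_)
      have : 0 ≤ ∏ i ∈ Finset.range (n + 1), 1 / B i ^ 2 := Finset.prod_nonneg fun i _ => by
        positivity
      gcongr
    rw [edist_dist, edist_dist, ENNReal.ofReal_rpow_of_nonneg dist_nonneg s.coe_nonneg,
      ← ENNReal.ofReal_coe_nnreal, ← ENNReal.ofReal_mul C.coe_nonneg]
    exact ENNReal.ofReal_le_ofReal h3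
  have h1 := mul_dimH_le_dimH_image hs hanti
  rw [Real.dimH_of_nonempty_interior (by simp), Module.finrank_self, Nat.cast_one, mul_one] at h1
  refine h1.trans (dimH_mono ?_)
  rintro _ ⟨y, hy, rfl⟩
  exact ⟨hg y, fun n => by rw [hgd y hy]; exact Subtype.coe_prop _⟩

/-! ### Dimension of sets of points with restricted digits: upper bound -/

/-- Each choice of the first n digit vectors gives one covering set, of sup-diameter at most ∏ 1 / b
i ^ 2. By `hC` the s-sums of these covers stay below `C`, so the s-dimensional measure is finite. -/
theorem dimH_le_of_digit_cover {d : ℕ} (A : ℕ → Finset (Fin d → ℕ)) (b : ℕ → ℝ)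
    (hb : ∀ n, 0 < b n) (hA : ∀ n, ∀ v ∈ A n, ∀ j, b n ≤ v j) {F : Set (Fin d → ℝ)}
    (hF : ∀ x ∈ F, x ∈ irrCube d ∧ ∀ n, digitVec x n ∈ A n) {s C : NNReal}
    (htend : Tendsto (fun n => ∏ i ∈ Finset.range n, 1 / b i ^ 2) atTop (𝓝 0))
    (hC : ∀ n, (∏ i ∈ Finset.range n, ((A i).card : ℝ)) *
      (∏ i ∈ Finset.range n, 1 / b i ^ 2) ^ (s : ℝ) ≤ C) :
    dimH F ≤ s := by
  borelize (Fin d → ℝ)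
  apply dimH_le_of_hausdorffMeasure_ne_top
  set r : ℕ → ℝ := fun n => ∏ i ∈ Finset.range n, 1 / b i ^ 2
  have hr : ∀ n, 0 ≤ r n := fun n => Finset.prod_nonneg fun i _ => by positivity
  let t : ∀ n : ℕ, (∀ i : Fin n, A i) → Set (Fin d → ℝ) := fun n p =>
    {x ∈ F | ∀ i : Fin n, digitVec x i = p i}
  have hdiam : ∀ n p, Metric.ediam (t n p) ≤ ENNReal.ofReal (r n) := by
    intro n p
    refine Metric.ediam_le fun x hx y hy => ?_
    rw [edist_dist]
    refine ENNReal.ofReal_le_ofReal ((dist_pi_le_iff (hr n)).mpr fun j => ?_)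
    refine abs_sub_le_prod_of_digit_eq b n ((hF x hx.1).1 j) ((hF y hy.1).1 j)
      (fun i _ => ⟨hb i, hA i _ ((hF x hx.1).2 i) j⟩) fun i hi => ?_
    exact congrFun ((hx.2 ⟨i, hi⟩).trans (hy.2 ⟨i, hi⟩).symm) j
  have hcover : ∀ n, F ⊆ ⋃ p, t n p := fun n x hx =>
    Set.mem_iUnion.mpr ⟨fun i => ⟨digitVec x i, (hF x hx).2 i⟩, hx, fun i => rfl⟩
  have hle := MeasureTheory.Measure.hausdorffMeasure_le_liminf_sum (s : ℝ) F (l := atTop)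
    (fun n => ENNReal.ofReal (r n)) (by simpa using ENNReal.tendsto_ofReal htend) t
    (Eventually.of_forall hdiam) (Eventually.of_forall hcover)
  refine ne_top_of_le_ne_top (ENNReal.coe_ne_top (r := C)) (hle.trans ?_)
  refine (liminf_le_liminf (v := fun _ : ℕ => (C : ENNReal)) (Eventually.of_forall fun n => ?_)).trans
    (liminf_const _).le
  calc ∑ p, Metric.ediam (t n p) ^ (s : ℝ)
      ≤ ∑ p : (∀ i : Fin n, A i), ENNReal.ofReal (r n) ^ (s : ℝ) := by
        gcongr with p; exact hdiam n p
    _ = ENNReal.ofReal ((∏ i ∈ Finset.range n, ((A i).card : ℝ)) * r n ^ (s : ℝ)) := by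
        rw [Finset.sum_const, Finset.card_univ, Fintype.card_pi, nsmul_eq_mul,
          ENNReal.ofReal_mul (Finset.prod_nonneg fun i _ => by positivity),
          ENNReal.ofReal_rpow_of_nonneg (hr n) s.coe_nonneg,
          Finset.prod_range (fun i => ((A i).card : ℝ)), ← Nat.cast_prod, ENNReal.ofReal_natCast]
        simp
    _ ≤ C := by
        rw [← ENNReal.ofReal_coe_nnreal]
        exact ENNReal.ofReal_le_ofReal (hC n)

/-! ### Dimension of seed sets -/

/-- Once the factors are at least 1 the partial products no longer decrease, so the least of the
finitely many earlier ones is a lower bound. -/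
theorem exists_pos_le_prod_range {w : ℕ → ℝ} (hw : ∀ i, 0 < w i) (h : ∀ᶠ i in atTop, 1 ≤ w i) :
    ∃ c > 0, ∀ n, c ≤ ∏ i ∈ Finset.range n, w i := by
  obtain ⟨N, hN⟩ := eventually_atTop.mp h
  obtain ⟨m, -, hm⟩ := Finset.exists_min_image (Finset.range (N + 1))
    (fun n => ∏ i ∈ Finset.range n, w i) ⟨0, by simp⟩
  refine ⟨∏ i ∈ Finset.range m, w i, Finset.prod_pos fun i _ => hw i, fun n => ?_⟩
  rcases le_total n N with hn | hn
  · exact hm n (by simpa [Nat.lt_succ_iff] using hn)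
  · induction n, hn using Nat.le_induction with
    | base => exact hm N (by simp)
    | succ n hn ih =>
      rw [Finset.prod_range_succ]
      exact ih.trans (le_mul_of_one_le_right (Finset.prod_nonneg fun i _ => (hw i).le) (hN n hn))

theorem exists_prod_range_le {w : ℕ → ℝ} (hw : ∀ i, 0 < w i) (h : ∀ᶠ i in atTop, w i ≤ 1) :
    ∃ C > 0, ∀ n, ∏ i ∈ Finset.range n, w i ≤ C := by
  obtain ⟨c, hc, hle⟩ := exists_pos_le_prod_range (w := fun i => (w i)⁻¹)
    (fun i => inv_pos.mpr (hw i)) (h.mono fun i hi => (one_le_inv₀ (hw i)).mpr hi)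
  refine ⟨c⁻¹, inv_pos.mpr hc, fun n => ?_⟩
  have := hle n
  rw [Finset.prod_inv_distrib] at this
  exact (le_inv_comm₀ hc (Finset.prod_pos fun i _ => hw i)).mp this

theorem tendsto_prod_range_zero {w : ℕ → ℝ} (hw : ∀ i, 0 < w i)
    (h : Tendsto w atTop (𝓝 0)) : Tendsto (fun n => ∏ i ∈ Finset.range n, w i) atTop (𝓝 0) := by
  obtain ⟨C, hC, hle⟩ := exists_prod_range_le (w := fun i => 2 * w i)
    (fun i => by have := hw i; positivity)
    ((h.eventually_le_const one_half_pos).mono fun i hi => by linarith)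
  have h2 : Tendsto (fun n : ℕ => C * (1 / 2 : ℝ) ^ n) atTop (𝓝 0) := by
    simpa using (tendsto_pow_atTop_nhds_zero_of_lt_one (by norm_num : (0 : ℝ) ≤ 1 / 2)
      (by norm_num)).const_mul C
  refine squeeze_zero (fun n => Finset.prod_nonneg fun i _ => (hw i).le) (fun n => ?_) h2
  have := hle n
  rw [Finset.prod_mul_distrib, Finset.prod_const, Finset.card_range] at this
  rw [one_div, inv_pow, ← div_eq_mul_inv, le_div_iff₀ (by positivity)]
  linarith

theorem tendsto_pow_succ_atTop {t : ℝ} (ht : 1 < t) :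
    Tendsto (fun n : ℕ => t ^ (n + 1)) atTop atTop :=
  (tendsto_pow_atTop_atTop_of_one_lt ht).comp (tendsto_add_atTop_nat 1)

section SeedSets

variable {d : ℕ} {S T : Set (Fin d → ℕ)} {α t L : ℝ}

/-- The points all of whose digit vectors lie in `T`, the `n`-th one having sup norm in
`[t ^ n, L * t ^ n)`. -/
def shellSet (T : Set (Fin d → ℕ)) (t L : ℝ) : Set (Fin d → ℝ) :=
  {x ∈ irrCube d | ∀ n, digitVec x n ∈ shell T (t ^ (n + 1)) (L * t ^ (n + 1))}

theorem seedSet_injSpace (hL : 1 < L) (ht : L < t) :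
    seedSet (injSpace d) t L T = shellSet T t L := by
  ext x
  refine ⟨fun h => ⟨h.1.1, h.2⟩, fun h => ⟨⟨h.1, ?_⟩, h.2⟩⟩
  have hlt : ∀ m n, m < n → digitVec x m ≠ digitVec x n := by
    intro m n hmn heq
    have h1 := (h.2 m).2.2
    have h2 := (h.2 n).2.1
    rw [heq] at h1
    have h3 : t ^ (m + 2) ≤ t ^ (n + 1) := pow_le_pow_right₀ (by linarith) (by omega)
    have h4 : L * t ^ (m + 1) ≤ t ^ (m + 2) := by
      rw [pow_succ' t (m + 1)]
      have : 0 ≤ t ^ (m + 1) := pow_nonneg (by linarith) _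
      gcongr
    linarith
  intro m n hmn
  rcases lt_or_gt_of_ne hmn with h | h
  · exact hlt m n h
  · exact (hlt n m h).symm

theorem div_le_of_mem_balanced (hd : 0 < d) {K : ℝ} (hK : 1 ≤ K) {v : Fin d → ℕ}
    (hv : v ∈ balanced d K) {a : ℝ} (ha : a ≤ supNorm v) (j : Fin d) : a / K ≤ v j := by
  obtain ⟨i, hi⟩ := exists_eq_supNorm hd v
  rw [div_le_iff₀ (by linarith), mul_comm]
  rw [← hi] at ha
  exact ha.trans (hv.2 i j)

theorem seedSet_divSpace (hd : 0 < d) {K : ℝ} (hK : 1 ≤ K) (hT : T ⊆ balanced d K)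
    (ht : 1 < t) : seedSet (divSpace d) t L T = shellSet T t L := by
  ext x
  refine ⟨fun h => ⟨h.1.1, h.2⟩, fun h => ⟨⟨h.1, fun j => ?_⟩, h.2⟩⟩
  refine tendsto_natCast_atTop_iff (R := ℝ).mp ?_
  exact tendsto_atTop_mono (fun n => div_le_of_mem_balanced hd hK (hT (h.2 n).1) (h.2 n).2.1 j)
    ((tendsto_pow_succ_atTop ht).atTop_div_const (by linarith))

/-- For s < δ/2 the n-th count is paired with scale n + 1. Scales grow only geometrically, so the
shift costs a constant per factor, which a positive power of t^(n+1) eventually absorbs. -/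
theorem le_dimH_shellSet (hTpos : T ⊆ posVec d) (hsep : TwoSeparated T) (hL : 1 < L) (ht : L < t)
    (hne : ∀ n : ℕ, (shell T (t ^ (n + 1)) (L * t ^ (n + 1))).Nonempty) {δ : ℝ} (hδ : 0 < δ)
    (hcount : ∀ ε, 0 < ε → ε < δ → ∃ c > 0, ∀ n : ℕ,
      c * (t ^ (n + 1)) ^ (δ - ε) ≤ (shell T (t ^ (n + 1)) (L * t ^ (n + 1))).ncard) :
    ENNReal.ofReal (δ / 2) ≤ dimH (shellSet T t L) := by
  refine ENNReal.le_of_forall_nnreal_lt fun s hs => ?_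
  rcases eq_or_ne s 0 with rfl | hs0
  · simp
  have hspos : 0 < s := pos_iff_ne_zero.mpr hs0
  have hspos' : (0 : ℝ) < s := hspos
  have hs' : (s : ℝ) < δ / 2 := by
    rwa [← ENNReal.ofReal_coe_nnreal, ENNReal.ofReal_lt_ofReal_iff (by positivity)] at hs
  have hfin : ∀ n : ℕ, (shell T (t ^ (n + 1)) (L * t ^ (n + 1))).Finite := fun n =>
    (shell_ncard_le subset_rfl hTpos _ _).1
  have ht0 : 0 < t := by linarith
  set M : ℕ → ℝ := fun n => t ^ (n + 1) with hM
  have hM1 : ∀ n, 1 ≤ M n := fun n => one_le_pow₀ (by linarith)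
  have hM0 : ∀ n, 0 < M n := fun n => by linarith [hM1 n]
  set A : ℕ → Finset (Fin d → ℕ) := fun n => (hfin n).toFinset
  -- The factor 2 absorbs the + 1 in the bound on digits.
  set B : ℕ → ℝ := fun n => 2 * L * M n
  have hB0 : ∀ n, 0 < B n := fun n => by have := hM0 n; positivity
  have hAcard : ∀ n, ((A n).card : ℝ) = (shell T (M n) (L * M n)).ncard := fun n => by
    rw [Set.ncard_eq_toFinset_card _ (hfin n)]
  have hAne : ∀ n, (A n).Nonempty := fun n => (hfin n).toFinset_nonempty.mpr (hne n)
  have hA1 : ∀ n, (1 : ℝ) ≤ (A n).card := fun n => by exact_mod_cast (hAne n).card_pos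
  have hmemA : ∀ n v, v ∈ A n ↔ v ∈ shell T (M n) (L * M n) := fun n v => (hfin n).mem_toFinset
  have hAset : shellSet T t L = {x ∈ irrCube d | ∀ n, digitVec x n ∈ A n} := by
    ext x; simp only [shellSet, hmemA, hM]
  -- Half of the slack δ - 2s is given to the count; the other half remains as the growing power of
  -- `M n`.
  obtain ⟨c, hc, hcle⟩ := hcount (δ / 2 - s) (by linarith) (by linarith)
  have hgrow : ∀ᶠ n in atTop, 1 ≤ ((A n).card : ℝ) * (1 / B (n + 1) ^ 2) ^ (s : ℝ) := by
    have htend : Tendsto (fun n => c * (1 / (2 * L * t) ^ 2) ^ (s : ℝ) *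
        M n ^ (δ / 2 - s)) atTop atTop :=
      Tendsto.const_mul_atTop (by positivity)
        ((tendsto_rpow_atTop (by linarith)).comp (tendsto_pow_succ_atTop (by linarith)))
    filter_upwards [htend.eventually_ge_atTop 1] with n hn
    refine hn.trans ?_
    have h1 : (1 / B (n + 1) ^ 2) = 1 / (2 * L * t) ^ 2 * (M n ^ (2 : ℝ))⁻¹ := by
      simp only [B, hM, Real.rpow_two]
      rw [pow_succ t (n + 1)]
      field_simp
    have h2 : M n ^ (δ / 2 - s) = M n ^ (δ - (δ / 2 - s)) * ((M n ^ (2 : ℝ))⁻¹) ^ (s : ℝ) := by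
      rw [← Real.rpow_neg (hM0 n).le, ← Real.rpow_mul (hM0 n).le, ← Real.rpow_add (hM0 n)]
      ring_nf
    have hMn := hM0 n
    rw [h1, Real.mul_rpow (by positivity) (by positivity), h2, hAcard]
    calc _ = (c * M n ^ (δ - (δ / 2 - s))) * ((1 / (2 * L * t) ^ 2) ^ (s : ℝ) *
          ((M n ^ (2 : ℝ))⁻¹) ^ (s : ℝ)) := by ring
      _ ≤ _ := by gcongr; exact hcle n
  have hcardtend : Tendsto (fun n => ((A n).card : ℝ)) atTop atTop := by
    refine tendsto_atTop_mono (fun n => by rw [hAcard]; exact hcle n)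
      (Tendsto.const_mul_atTop hc ?_)
    exact (tendsto_rpow_atTop (by linarith)).comp (tendsto_pow_succ_atTop (by linarith))
  obtain ⟨c₀, hc₀, hc₀le⟩ := exists_pos_le_prod_range (fun i => by
    have := hA1 i; have := hB0 (i + 1); positivity) hgrow
  rw [hAset]
  refine le_dimH_of_branching A B hAne (fun n v hv => hTpos ((hmemA n v).mp hv).1)
    (fun n => ?_) (fun n v hv j => ?_) hspos
    -- The shifted pairing leaves the scale `B 0` unmatched, and the constant pays for it.
    (C := NNReal.mk (c₀ * (1 / B 0 ^ 2) ^ (s : ℝ))⁻¹ (by have := hB0 0; positivity)) ?_ fun n => ?_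
  · exact hsep.mono fun v hv => ((hmemA n v).mp hv).1
  · have h1 : (v j : ℝ) ≤ supNorm v := by exact_mod_cast le_supNorm v j
    have h2 := ((hmemA n v).mp hv).2.2
    have h3 : 1 ≤ L * M n := one_le_mul_of_one_le_of_one_le hL.le (hM1 n)
    simp only [B]
    linarith
  · rw [← tendsto_add_atTop_iff_nat 1]
    refine tendsto_atTop_mono (fun n => ?_) hcardtend
    rw [Finset.prod_range_succ]
    refine le_mul_of_one_le_left (by positivity) ?_
    have h1 : 1 ≤ ∏ i ∈ Finset.range n, (A i).card :=
      Nat.one_le_iff_ne_zero.mpr (Finset.prod_ne_zero_iff.mpr fun i _ => (hAne i).card_pos.ne')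
    exact_mod_cast h1
  · have hP : 0 < ∏ i ∈ Finset.range n, ((A i).card : ℝ) :=
      Finset.prod_pos fun i _ => by linarith [hA1 i]
    have hQ : 0 ≤ ∏ i ∈ Finset.range n, 1 / B (i + 1) ^ 2 :=
      Finset.prod_nonneg fun i _ => by positivity
    have h := hc₀le n
    rw [Finset.prod_mul_distrib, Real.finsetProd_rpow _ _ fun i _ => by positivity] at h
    rw [Finset.prod_range_succ', Real.mul_rpow hQ (by positivity), NNReal.coe_mk, mul_inv]
    have hB : 0 < (1 / B 0 ^ 2) ^ (s : ℝ) := by have := hB0 0; positivity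
    generalize ∏ i ∈ Finset.range n, ((A i).card : ℝ) = P at hP h ⊢
    generalize ∏ i ∈ Finset.range n, 1 / B (i + 1) ^ 2 = Q at hQ h ⊢
    calc P⁻¹ = c₀⁻¹ * (c₀ * P⁻¹) := by field_simp
      _ ≤ c₀⁻¹ * Q ^ (s : ℝ) := by
        gcongr
        rwa [← div_eq_mul_inv, div_le_iff₀ hP, mul_comm]
      _ = _ := by field_simp

theorem dimH_shellSet_le (hd : 0 < d) {K : ℝ} (hK : 1 ≤ K) (hT : T ⊆ balanced d K) (hL : 1 < L)
    (ht : L < t) (hne : ∀ n : ℕ, (shell T (t ^ (n + 1)) (L * t ^ (n + 1))).Nonempty) {δ : ℝ}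
    (hδ : 0 < δ)
    (hcount : ∀ ε, 0 < ε → ∃ C > 0, ∀ n : ℕ,
      ((shell T (t ^ (n + 1)) (L * t ^ (n + 1))).ncard : ℝ) ≤ C * (t ^ (n + 1)) ^ (δ + ε)) :
    dimH (shellSet T t L) ≤ ENNReal.ofReal (δ / 2) := by
  have hTpos : T ⊆ posVec d := fun v hv => (hT hv).1
  refine ENNReal.le_of_forall_pos_le_add fun ε hε _ => ?_
  have hε' : (0 : ℝ) < ε := hε
  rw [ENNReal.ofReal, ← ENNReal.coe_add]
  -- The count loses ε and the scale gains 2ε, leaving the decaying factor `M n` ^ (-ε).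
  set s : NNReal := (δ / 2).toNNReal + ε with hs
  have hs' : (s : ℝ) = δ / 2 + ε := by
    rw [hs, NNReal.coe_add, Real.coe_toNNReal _ (by positivity)]
  have hfin : ∀ n : ℕ, (shell T (t ^ (n + 1)) (L * t ^ (n + 1))).Finite := fun n =>
    (shell_ncard_le subset_rfl hTpos _ _).1
  have ht0 : 0 < t := by linarith
  have hK0 : 0 < K := by linarith
  set M : ℕ → ℝ := fun n => t ^ (n + 1) with hM
  have hM1 : ∀ n, 1 ≤ M n := fun n => one_le_pow₀ (by linarith)
  have hM0 : ∀ n, 0 < M n := fun n => by linarith [hM1 n]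
  have hMtend : Tendsto M atTop atTop := tendsto_pow_succ_atTop (by linarith)
  set A : ℕ → Finset (Fin d → ℕ) := fun n => (hfin n).toFinset
  set b : ℕ → ℝ := fun n => M n / K
  have hb0 : ∀ n, 0 < b n := fun n => by have := hM0 n; positivity
  have hAcard : ∀ n, ((A n).card : ℝ) = (shell T (M n) (L * M n)).ncard := fun n => by
    rw [Set.ncard_eq_toFinset_card _ (hfin n)]
  have hAne : ∀ n, (A n).Nonempty := fun n => (hfin n).toFinset_nonempty.mpr (hne n)
  have hA1 : ∀ n, (1 : ℝ) ≤ (A n).card := fun n => by exact_mod_cast (hAne n).card_pos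
  have hmemA : ∀ n v, v ∈ A n ↔ v ∈ shell T (M n) (L * M n) := fun n v => (hfin n).mem_toFinset
  obtain ⟨C, hC, hCle⟩ := hcount ε hε
  have hdecay : ∀ᶠ n in atTop, ((A n).card : ℝ) * (1 / b n ^ 2) ^ (s : ℝ) ≤ 1 := by
    have htend : Tendsto (fun n => C * (K ^ 2) ^ (s : ℝ) * M n ^ (-(ε : ℝ))) atTop (𝓝 0) := by
      simpa using ((tendsto_rpow_neg_atTop hε').comp hMtend).const_mul (C * (K ^ 2) ^ (s : ℝ))
    filter_upwards [htend.eventually_le_const one_pos] with n hn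
    refine le_trans ?_ hn
    have hMn := hM0 n
    have h1 : 1 / b n ^ 2 = K ^ 2 * (M n ^ (2 : ℝ))⁻¹ := by
      simp only [b, Real.rpow_two]
      field_simp
    have h2 : M n ^ (-(ε : ℝ)) = M n ^ (δ + ε) * ((M n ^ (2 : ℝ))⁻¹) ^ (s : ℝ) := by
      rw [← Real.rpow_neg hMn.le, ← Real.rpow_mul hMn.le, ← Real.rpow_add hMn, hs']
      ring_nf
    rw [h1, Real.mul_rpow (by positivity) (by positivity), h2, hAcard]
    calc _ ≤ (C * M n ^ (δ + ε)) * ((K ^ 2) ^ (s : ℝ) * ((M n ^ (2 : ℝ))⁻¹) ^ (s : ℝ)) := by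
          gcongr; exact hCle n
      _ = _ := by ring
  obtain ⟨C₀, hC₀, hC₀le⟩ := exists_prod_range_le (fun i => by
    have := hA1 i; have := hb0 i; positivity) hdecay
  refine dimH_le_of_digit_cover A b hb0 (fun n v hv j => ?_) (fun x hx => ⟨hx.1, fun n => ?_⟩)
    (C := NNReal.mk C₀ hC₀.le) ?_ fun n => ?_
  · have h := (hmemA n v).mp hv
    exact div_le_of_mem_balanced hd hK (hT h.1) h.2.1 j
  · exact (hmemA n _).mpr (hx.2 n)
  · refine tendsto_prod_range_zero (fun i => by have := hb0 i; positivity) ?_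
    have h1 : Tendsto b atTop atTop := hMtend.atTop_div_const hK0
    simp only [one_div]
    exact ((tendsto_pow_atTop two_ne_zero).comp h1).inv_tendsto_atTop
  · rw [← Real.finsetProd_rpow _ _ fun i _ => by positivity, ← Finset.prod_mul_distrib]
    exact hC₀le n

theorem shellSet_nonempty (hTpos : T ⊆ posVec d)
    (hne : ∀ n : ℕ, (shell T (t ^ (n + 1)) (L * t ^ (n + 1))).Nonempty) :
    (shellSet T t L).Nonempty := by
  choose a ha using hne
  obtain ⟨x, hx, hxa⟩ := exists_digitVec_eq (a := a) fun n => hTpos (ha n).1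
  exact ⟨x, hx, fun n => by rw [hxa]; exact ha n⟩

end SeedSets

end CFSeed

end

/-! ### Assembly of the proposition -/

theorem proposition5p6 (d : ℕ) (hd : 1 ≤ d) (S : Set (Fin d → ℕ)) (hSpos : S ⊆ CFSeed.posVec d)
    (α : ℝ) (hα : 1 ≤ α) (hS : CFSeed.HasPolyDensity S α) :
    ∃ Sstar : Set (Fin d → ℕ), Sstar ⊆ S ∧ CFSeed.relUpperDensity Sstar S = 0 ∧
      ∃ L t₀ : ℝ, 1 < L ∧ L < t₀ ∧ ∀ t : ℝ, t₀ ≤ t →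
        CFSeed.IsExtremeSeedSet (CFSeed.injSpace d) S α t L Sstar ∧
        ((∃ K : ℝ, 1 ≤ K ∧ S ⊆ CFSeed.balanced d K) →
          dimH (CFSeed.seedSet (CFSeed.injSpace d) t L Sstar)
              = ENNReal.ofReal ((d : ℝ) / (2 * α)) ∧
          CFSeed.IsExtremeSeedSet (CFSeed.divSpace d) S α t L Sstar ∧
          dimH (CFSeed.seedSet (CFSeed.divSpace d) t L Sstar)
              = ENNReal.ofReal ((d : ℝ) / (2 * α))) := by
  have hd' : (0 : ℝ) < d := by exact_mod_cast hd
  have hδ : 0 < (d : ℝ) / α := by positivity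
  obtain ⟨T, hTS, hdens, hsep, hinf, L, t₀, hL, hLt₀, hne, hcount⟩ :=
    CFSeed.exists_thin_subset hd hSpos hS hδ
  refine ⟨T, hTS, hdens, L, t₀, hL, hLt₀, fun t ht => ?_⟩
  have hLt : L < t := hLt₀.trans_le ht
  -- Every shell, from the first digit on, lies in the range where the thin set is controlled.
  have hpow : ∀ n : ℕ, t₀ ≤ t ^ (n + 1) := fun n =>
    ht.trans (le_self_pow₀ (by linarith) (Nat.succ_ne_zero n))
  have hTpos := hTS.trans hSpos
  have hne' : ∀ n : ℕ, (CFSeed.shell T (t ^ (n + 1)) (L * t ^ (n + 1))).Nonempty := fun n =>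
    hne _ (hpow n)
  have hdim : ENNReal.ofReal ((d : ℝ) / (2 * α)) ≤ dimH (CFSeed.shellSet T t L) := by
    rw [mul_comm, ← div_div]
    refine CFSeed.le_dimH_shellSet hTpos hsep hL hLt hne' hδ fun ε hε hεδ => ?_
    obtain ⟨c, hc, hcle⟩ := hcount ε hε hεδ
    exact ⟨c, hc, fun n => hcle _ (hpow n)⟩
  have hseed : ∀ X : Set (Fin d → ℝ), CFSeed.seedSet X t L T = CFSeed.shellSet T t L →
      CFSeed.IsExtremeSeedSet X S α t L T := fun X hX =>
    { infinite_ambient := hinf.mono hTS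
      subset := hTS
      infinite := hinf
      one_lt := hL
      lt := hLt
      nonempty := hX ▸ CFSeed.shellSet_nonempty hTpos hne'
      one_le := hα
      polyDensity := hS
      twoSeparated := hsep
      relUpperDensity_eq_zero := hdens
      le_dimH := hX ▸ hdim }
  have hinj := CFSeed.seedSet_injSpace (T := T) hL hLt
  refine ⟨hseed _ hinj, ?_⟩
  rintro ⟨K, hK, hbal⟩
  have hdiv := CFSeed.seedSet_divSpace (t := t) (L := L) hd hK (hTS.trans hbal) (by linarith)
  have heq : dimH (CFSeed.shellSet T t L) = ENNReal.ofReal ((d : ℝ) / (2 * α)) := by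
    refine le_antisymm ?_ hdim
    rw [mul_comm, ← div_div]
    refine CFSeed.dimH_shellSet_le hd hK (hTS.trans hbal) hL hLt hne' hδ fun ε hε => ?_
    obtain ⟨C, hC, hCle⟩ := hS.boxCount_le hε hδ
    refine ⟨C * L ^ ((d : ℝ) / α + ε), by positivity, fun n => ?_⟩
    have h1 : 1 ≤ L * t ^ (n + 1) :=
      one_le_mul_of_one_le_of_one_le hL.le (one_le_pow₀ (by linarith))
    have h2 : ((CFSeed.shell T (t ^ (n + 1)) (L * t ^ (n + 1))).ncard : ℝ) ≤
        (S ∩ CFSeed.box d ⌊L * t ^ (n + 1)⌋₊).ncard := by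
      exact_mod_cast (CFSeed.shell_ncard_le hTS hSpos _ _).2
    refine h2.trans ((hCle _ (Nat.le_floor (by simpa using h1))).trans ?_)
    have ht0 : 0 < t := by linarith
    rw [mul_assoc, ← Real.mul_rpow (by linarith) (by positivity)]
    gcongr
    exact Nat.floor_le (by linarith)
  exact ⟨hinj ▸ heq, hseed _ hdiv, hdiv ▸ heq⟩
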